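/- Work over $\mathbb{C}$ and let $n\ge 1$ be an integer. Let $\mathbb{F}_n=\mathbb{P}(\mathcal{O}_{\mathbb{P}^1}\oplus\mathcal{O}_{\mathbb{P}^1}(-n))$ be the Segre–Hirzebruch surface, let $C_0$ be its negative section ($C_0^2=-n$) and $F$ the class of a fibre of $\mathbb{F}_n\to\mathbb{P}^1$. Put $A=2C_0-F$, and let $X=\mathbb{P}(\mathcal{O}_{\mathbb{F}_n}\oplus\mathcal{O}_{\mathbb{F}_n}(-A))$ be the projective bundle of hyperplanes (rank one quotients), with $\tau=c_1(\mathcal{O}_X(1))$; divisor classes on $\mathbb{F}_n$ and their pullbacks to $X$ are denoted by the same symbol. Then: 1. each of the linear systems $|\tau+A|$ and $|C_0|$ on $X$ consists of exactly one effective divisor (the classes are rigid); call these divisors $R$ and $U$ respectively; 2. the scheme-theoretic intersection $\sigma=R\cap U$ is a complete intersection (local equations of $R$ and $U$ form a regular sequence along $\sigma$) and is a smooth rational curve, i.e. $\sigma\cong\mathbb{P}^1_{\mathbb{C}}$ over $\mathbb{C}$; 3. the base locus of the complete linear system $|-2K_X|$ (the set of points common to all its members) is exactly the set of points of $\sigma$.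 -/

import Mathlib

open AlgebraicGeometry CategoryTheory CategoryTheory.Limits
open scoped KaehlerDifferential

noncomputable section

/-! ### Gluing a variety from coordinate rings inside one field -/

/-- The elements `x` of `K` with `f ^ m * x ∈ R` for some `m`, i.e. the localization `R[1/f]`
inside the field `K`. -/
def awaySubalgebra {K : Type} [Field K] [Algebra ℂ K] (R : Subalgebra ℂ K) (f : K) (hf : f ∈ R) :
    Subalgebra ℂ K where
  carrier := {x | ∃ m : ℕ, f ^ m * x ∈ R}
  mul_mem' := by
    rintro a b ⟨m, hm⟩ ⟨k, hk⟩
    refine ⟨m + k, ?_⟩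
    have h := R.mul_mem hm hk
    have e : f ^ (m + k) * (a * b) = f ^ m * a * (f ^ k * b) := by ring
    rwa [e]
  add_mem' := by
    rintro a b ⟨m, hm⟩ ⟨k, hk⟩
    refine ⟨m + k, ?_⟩
    have h := R.add_mem (R.mul_mem (R.pow_mem hf k) hm) (R.mul_mem (R.pow_mem hf m) hk)
    have e : f ^ (m + k) * (a + b) = f ^ k * (f ^ m * a) + f ^ m * (f ^ k * b) := by ring
    rwa [e]
  algebraMap_mem' c := ⟨0, by simp [R.algebraMap_mem c]⟩

/-- An affine atlas with all coordinate rings inside a field `K`: finitely or infinitely many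
`ℂ`-subalgebras `ring i` of `K`, the index set being closed under intersection of charts.  The
chart of `i ⊓ j` is the intersection of the charts of `i` and `j` and has coordinate ring
`ring i ⊔ ring j` (separatedness); if `i ≤ j`, the chart of `i` is a principal open subset of
the chart of `j`. -/
structure Atlas (K : Type) [Field K] [Algebra ℂ K] where
  /-- the indices of the charts -/
  ι : Type
  /-- `i ⊓ j` is the index of the intersection of two charts -/
  [semilatticeInf : SemilatticeInf ι]
  /-- the coordinate ring of a chart -/
  ring : ι → Subalgebra ℂ K
  ring_inf : ∀ i j, ring (i ⊓ j) = ring i ⊔ ring j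
  exists_away : ∀ i j, i ≤ j → ∃ f : K, f ≠ 0 ∧ f ∈ ring j ∧ f⁻¹ ∈ ring i ∧
    ∀ x ∈ ring i, ∃ m : ℕ, f ^ m * x ∈ ring j

attribute [instance] Atlas.semilatticeInf

namespace Atlas

variable {K : Type} [Field K] [Algebra ℂ K] (𝒜 : Atlas K)

theorem ring_anti {i j : 𝒜.ι} (h : i ≤ j) : 𝒜.ring j ≤ 𝒜.ring i := by
  have e := 𝒜.ring_inf i j
  rw [inf_eq_left.mpr h] at e
  rw [e]
  exact le_sup_right

theorem isLocalization_inclusion {R S : Subalgebra ℂ K} (h : R ≤ S) (f : K) (hf0 : f ≠ 0)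
    (hfR : f ∈ R) (hfS : f⁻¹ ∈ S) (hloc : ∀ x ∈ S, ∃ m : ℕ, f ^ m * x ∈ R) :
    let _ := (Subalgebra.inclusion h).toRingHom.toAlgebra
    IsLocalization.Away (⟨f, hfR⟩ : R) S := by
  let _ := (Subalgebra.inclusion h).toRingHom.toAlgebra
  have hmap : ∀ a : R, ((algebraMap R S a : S) : K) = a := fun a => rfl
  refine (isLocalization_iff _ _).mpr ⟨?_, ?_, ?_⟩
  · rintro ⟨_, m, rfl⟩
    rw [map_pow]
    refine IsUnit.pow m (IsUnit.of_mul_eq_one ⟨f⁻¹, hfS⟩ ?_)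
    ext
    simp [hmap, hf0]
  · rintro ⟨x, hx⟩
    obtain ⟨m, hm⟩ := hloc x hx
    refine ⟨(⟨f ^ m * x, hm⟩, ⟨⟨f, hfR⟩ ^ m, m, rfl⟩), ?_⟩
    ext
    simp [hmap, mul_comm]
  · intro a b hab
    refine ⟨1, ?_⟩
    have hK : (a : K) = b := by rw [← hmap a, ← hmap b, hab]
    rw [Subtype.ext hK]

/-- The diagram of affine charts `Spec (ring i)`. -/
def diagram : 𝒜.ι ⥤ Scheme.{0} where
  obj i := Spec (CommRingCat.of (𝒜.ring i))
  map f := Spec.map (CommRingCat.ofHom (Subalgebra.inclusion (𝒜.ring_anti f.le)).toRingHom)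
  map_id i := by
    rw [← Spec.map_id]
    rfl
  map_comp f g := by
    rw [← Spec.map_comp]
    rfl

instance isOpenImmersion_diagram_map {i j : 𝒜.ι} (f : i ⟶ j) :
    IsOpenImmersion (𝒜.diagram.map f) := by
  obtain ⟨x, h0, hj, hi, hloc⟩ := 𝒜.exists_away i j f.le
  let _ := (Subalgebra.inclusion (𝒜.ring_anti f.le)).toRingHom.toAlgebra
  have := isLocalization_inclusion (𝒜.ring_anti f.le) x h0 hj hi hloc
  exact IsOpenImmersion.of_isLocalization (R := 𝒜.ring j) (S := 𝒜.ring i) ⟨x, hj⟩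

instance isLocallyDirected_diagram : (𝒜.diagram ⋙ Scheme.forget).IsLocallyDirected where
  cond := by
    intro i j k fi fj xi xj hx
    obtain ⟨f, h0, hk, hj, hloc⟩ := 𝒜.exists_away j k fj.le
    have hki : 𝒜.ring k ≤ 𝒜.ring i := 𝒜.ring_anti fi.le
    have hl : i ⊓ j ≤ i := inf_le_left
    have hloc' : ∀ x ∈ 𝒜.ring (i ⊓ j), ∃ m : ℕ, f ^ m * x ∈ 𝒜.ring i := by
      have hle : 𝒜.ring (i ⊓ j) ≤ awaySubalgebra (𝒜.ring i) f (hki hk) := by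
        rw [𝒜.ring_inf]
        refine sup_le (fun x hx => ⟨0, by simpa using hx⟩) (fun x hx => ?_)
        obtain ⟨m, hm⟩ := hloc x hx
        exact ⟨m, hki hm⟩
      exact fun x hx => hle hx
    have hxi : xi ∈ Set.range (𝒜.diagram.map (homOfLE hl)) := by
      let _ := (Subalgebra.inclusion (𝒜.ring_anti hl)).toRingHom.toAlgebra
      have := isLocalization_inclusion (𝒜.ring_anti hl) f h0 (hki hk)
        (𝒜.ring_anti inf_le_right hj) hloc'
      have hr := PrimeSpectrum.localization_away_comap_range (R := 𝒜.ring i) (𝒜.ring (i ⊓ j))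
        ⟨f, hki hk⟩
      change xi ∈ Set.range (PrimeSpectrum.comap (algebraMap (𝒜.ring i) (𝒜.ring (i ⊓ j))))
      rw [hr]
      intro hmem
      have hxx : PrimeSpectrum.comap (Subalgebra.inclusion (𝒜.ring_anti fi.le)).toRingHom xi =
          PrimeSpectrum.comap (Subalgebra.inclusion (𝒜.ring_anti fj.le)).toRingHom xj := hx
      have h1 : (⟨f, hk⟩ : 𝒜.ring k) ∈
          (PrimeSpectrum.comap
            (Subalgebra.inclusion (𝒜.ring_anti fi.le)).toRingHom xi).asIdeal := hmem
      rw [hxx] at h1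
      have h2 : (⟨f, 𝒜.ring_anti fj.le hk⟩ : 𝒜.ring j) ∈ PrimeSpectrum.asIdeal xj := h1
      refine (PrimeSpectrum.isPrime xj).ne_top ((Ideal.eq_top_iff_one _).mpr ?_)
      have h3 := Ideal.mul_mem_left (PrimeSpectrum.asIdeal xj) (⟨f⁻¹, hj⟩ : 𝒜.ring j) h2
      have e : (⟨f⁻¹, hj⟩ : 𝒜.ring j) * ⟨f, 𝒜.ring_anti fj.le hk⟩ = 1 := by
        ext
        simp [h0]
      rwa [e] at h3
    obtain ⟨x, hxl⟩ := hxi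
    refine ⟨i ⊓ j, homOfLE hl, homOfLE inf_le_right, x, hxl, ?_⟩
    apply (𝒜.diagram.map fj).isOpenEmbedding.injective
    have e1 : 𝒜.diagram.map fj (𝒜.diagram.map (homOfLE inf_le_right) x) =
        𝒜.diagram.map fi (𝒜.diagram.map (homOfLE hl) x) := by
      rw [← Scheme.Hom.comp_apply, ← Scheme.Hom.comp_apply, ← Functor.map_comp,
        ← Functor.map_comp]
      rfl
    exact e1.trans ((congrArg (𝒜.diagram.map fi) hxl).trans hx)

/-- The scheme glued from the charts `Spec (ring i)`. -/
def toScheme : Scheme.{0} := colimit 𝒜.diagram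

/-- The open immersion of the chart `Spec (ring i)`. -/
def chart (i : 𝒜.ι) : Spec (CommRingCat.of (𝒜.ring i)) ⟶ 𝒜.toScheme := colimit.ι 𝒜.diagram i

/-- The structure morphism to `Spec ℂ`. -/
def structureMap : 𝒜.toScheme ⟶ Spec (CommRingCat.of ℂ) :=
  colimit.desc 𝒜.diagram
    { pt := Spec (CommRingCat.of ℂ)
      ι :=
        { app := fun i => Spec.map (CommRingCat.ofHom (algebraMap ℂ (𝒜.ring i)))
          naturality := by
            intro i j f
            refine (Spec.map_comp _ _).symm.trans ?_
            rfl } }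

/-! ### Line bundles, linear systems, base loci -/

/-- Line bundles given as invertible subsheaves of the constant sheaf `K`, i.e. Cartier divisors:
`D i` is a generator, over the chart `i`, of the sheaf `𝒪(D)`, and generators on nested charts
differ by units.  The group law, written additively, is the addition of divisors (the tensor
product of line bundles). -/
def lineBundles : AddSubgroup (𝒜.ι → Additive Kˣ) where
  carrier := {D | ∀ i j, i ≤ j → ((D i - D j).toMul : K) ∈ 𝒜.ring i ∧
    ((D j - D i).toMul : K) ∈ 𝒜.ring i}
  zero_mem' i j _ := by simp [(𝒜.ring i).one_mem]
  add_mem' := by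
    intro D E hD hE i j h
    constructor
    · have e : (D + E) i - (D + E) j = (D i - D j) + (E i - E j) := by
        simp only [Pi.add_apply]; abel
      rw [e, toMul_add, Units.val_mul]
      exact (𝒜.ring i).mul_mem (hD i j h).1 (hE i j h).1
    · have e : (D + E) j - (D + E) i = (D j - D i) + (E j - E i) := by
        simp only [Pi.add_apply]; abel
      rw [e, toMul_add, Units.val_mul]
      exact (𝒜.ring i).mul_mem (hD i j h).2 (hE i j h).2
  neg_mem' := by
    intro D hD i j h
    have e : ∀ a b : 𝒜.ι, (-D) a - (-D) b = D b - D a := fun a b => by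
      simp only [Pi.neg_apply]; abel
    rw [e, e]
    exact (hD i j h).symm

variable {𝒜} in
/-- The local generator over the chart `i` of the line bundle `D`. -/
def gen (D : 𝒜.lineBundles) (i : 𝒜.ι) : K := ((D.1 i).toMul : Kˣ)

variable {𝒜} in
/-- The global sections of `𝒪(D)`. -/
def IsSection (D : 𝒜.lineBundles) (s : K) : Prop := ∀ i, s / gen D i ∈ 𝒜.ring i

/-- The ideal sheaf of the closed subscheme `V(I)` of `Spec B`. -/
def idealSheafOfIdeal {B : Type} [CommRing B] (I : Ideal B) :
    (Spec (CommRingCat.of B)).IdealSheafData :=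
  (Spec.map (CommRingCat.ofHom (Ideal.Quotient.mk I))).ker

/-- The closed subscheme `Z` of `X` is given by the ideal `I i` on the chart `i`, for all `i`.
(Closed subschemes are represented by their quasi-coherent ideal sheaves.) -/
def IsCutOutBy (Z : 𝒜.toScheme.IdealSheafData) (I : ∀ i, Ideal (𝒜.ring i)) : Prop :=
  ∀ i, Z.comap (𝒜.chart i) = idealSheafOfIdeal (I i)

variable {𝒜} in
/-- The complete linear system `|D|`: the zero schemes of the nonzero global sections `s` of
`𝒪(D)`; on the chart `i` the zero scheme of `s` has the equation `s / gen D i`. -/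
def linearSystem (D : 𝒜.lineBundles) : Set 𝒜.toScheme.IdealSheafData :=
  {Z | ∃ s : K, s ≠ 0 ∧ IsSection D s ∧
    𝒜.IsCutOutBy Z fun i => Ideal.span {a : 𝒜.ring i | (a : K) = s / gen D i}}

/-- The regular `d`-forms on the chart `i`: the `ring i`-module generated by all
`da₁ ∧ ⋯ ∧ da_d` with `a₁, …, a_d ∈ ring i`, inside the rational `d`-forms.  If `X` is smooth of
dimension `d` with function field `K`, these are the sections over the chart `i` of the canonical
line bundle `ω_X`. -/
def regularForms (d : ℕ) (i : 𝒜.ι) : Submodule (𝒜.ring i) (⋀[K]^d Ω[K⁄ℂ]) :=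
  Submodule.span (𝒜.ring i)
    (Set.range fun a : Fin d → 𝒜.ring i =>
      exteriorPower.ιMulti K d fun k => KaehlerDifferential.D ℂ K (a k : K))

variable {d m : ℕ}

/-- The global sections of `ω_X^{⊗(-m)} = ℋom(ω_X^{⊗m}, 𝒪_X)`: the `K`-multilinear maps `θ` in `m`
rational top forms whose values on regular forms are regular functions, chart by chart. -/
def IsPluriAnticanonicalSection
    (θ : MultilinearMap K (fun _ : Fin m => ⋀[K]^d Ω[K⁄ℂ]) K) : Prop :=
  ∀ i, ∀ η : Fin m → ⋀[K]^d Ω[K⁄ℂ], (∀ k, η k ∈ 𝒜.regularForms d i) → θ η ∈ 𝒜.ring i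

variable (d m) in
/-- The linear system `|-m K_X|` for `X` smooth of dimension `d` with function field `K`: the zero
schemes of the nonzero global sections `θ : ω_X^{⊗m} → 𝒪_X` of `ω_X^{⊗(-m)}`.  The ideal sheaf of
the zero scheme of `θ` is the image of `θ`. -/
def antiCanonicalSystem : Set 𝒜.toScheme.IdealSheafData :=
  {Z | ∃ θ : MultilinearMap K (fun _ : Fin m => ⋀[K]^d Ω[K⁄ℂ]) K,
    θ ≠ 0 ∧ 𝒜.IsPluriAnticanonicalSection θ ∧
    𝒜.IsCutOutBy Z fun i => Ideal.span {a : 𝒜.ring i |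
      ∃ η : Fin m → ⋀[K]^d Ω[K⁄ℂ], (∀ k, η k ∈ 𝒜.regularForms d i) ∧ (a : K) = θ η}}

variable {𝒜} in
/-- The base locus of a linear system: the points common to all its members. -/
def baseLocus (𝔡 : Set 𝒜.toScheme.IdealSheafData) : Set 𝒜.toScheme :=
  ⋂ Z ∈ 𝔡, (Z.support : Set 𝒜.toScheme)

variable {𝒜} in
/-- Two effective Cartier divisors `Z`, `W` intersect completely: on every chart, equations
`a`, `b` of `Z`, `W` form a regular sequence (wherever `Z` and `W` meet). -/
def IntersectCompletely (Z W : 𝒜.toScheme.IdealSheafData) : Prop :=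
  ∀ i, ∃ a b : 𝒜.ring i,
    Z.comap (𝒜.chart i) = idealSheafOfIdeal (Ideal.span {a}) ∧
    W.comap (𝒜.chart i) = idealSheafOfIdeal (Ideal.span {b}) ∧
    RingTheory.Sequence.IsWeaklyRegular (𝒜.ring i) [a, b]

/-! ### The projective bundle `ℙ(𝒪 ⊕ L)` -/

/-- The charts of a `ℙ¹` with coordinate `u`: `fst` is `Spec ℂ[u]`, `snd` is `Spec ℂ[u⁻¹]`, and
`both` is their intersection. -/
inductive FiberChart : Type
  | fst
  | snd
  | both

namespace FiberChart

/-- The intersection of charts. -/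
def meet : FiberChart → FiberChart → FiberChart
  | fst, fst => fst
  | snd, snd => snd
  | _, _ => both

instance : Min FiberChart := ⟨meet⟩

instance : SemilatticeInf FiberChart :=
  SemilatticeInf.mk' (by intro a b; cases a <;> cases b <;> rfl)
    (by intro a b c; cases a <;> cases b <;> cases c <;> rfl)
    (by intro a; cases a <;> rfl)

/-- The functions adjoined to the coordinate ring of the base. -/
def coords (u : K) : FiberChart → Set K
  | fst => {u}
  | snd => {u⁻¹}
  | both => {u, u⁻¹}

theorem coords_inf (u : K) (c e : FiberChart) :
    coords u (c ⊓ e) = coords u c ∪ coords u e := by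
  cases c <;> cases e <;> ext x <;>
    simp only [coords, Min.min, meet, Set.mem_union, Set.mem_insert_iff,
      Set.mem_singleton_iff] <;> tauto

theorem adjoin_coords_le {R : Subalgebra ℂ K} {u v : K} (h : u / v ∈ R) (h' : v / u ∈ R)
    (hu : u ≠ 0) (hv : v ≠ 0) (c : FiberChart) :
    R ⊔ Algebra.adjoin ℂ (coords u c) ≤ R ⊔ Algebra.adjoin ℂ (coords v c) := by
  refine sup_le le_sup_left (Algebra.adjoin_le ?_)
  have hR : ∀ x ∈ R, x ∈ R ⊔ Algebra.adjoin ℂ (coords v c) :=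
    fun x hx => (le_sup_left : R ≤ _) hx
  have hC : ∀ x ∈ coords v c, x ∈ R ⊔ Algebra.adjoin ℂ (coords v c) :=
    fun x hx => (le_sup_right : _ ≤ R ⊔ Algebra.adjoin ℂ (coords v c)) (Algebra.subset_adjoin hx)
  have e1 : u = u / v * v := by field_simp
  have e2 : u⁻¹ = v / u * v⁻¹ := by field_simp
  intro x hx
  cases c
  · obtain rfl : x = u := hx
    have := mul_mem (hR _ h) (hC v rfl)
    rwa [← e1] at this
  · obtain rfl : x = u⁻¹ := hx
    have := mul_mem (hR _ h') (hC v⁻¹ rfl)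
    rwa [← e2] at this
  · rcases hx with rfl | hx
    · have := mul_mem (hR _ h) (hC v (Or.inl rfl))
      rwa [← e1] at this
    · obtain rfl : x = u⁻¹ := hx
      have := mul_mem (hR _ h') (hC v⁻¹ (Or.inr rfl))
      rwa [← e2] at this

theorem adjoin_coords_eq {R : Subalgebra ℂ K} {u v : K} (h : u / v ∈ R) (h' : v / u ∈ R)
    (hu : u ≠ 0) (hv : v ≠ 0) (c : FiberChart) :
    R ⊔ Algebra.adjoin ℂ (coords u c) = R ⊔ Algebra.adjoin ℂ (coords v c) :=
  le_antisymm (adjoin_coords_le h h' hu hv c) (adjoin_coords_le h' h hv hu c)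

end FiberChart

theorem gen_ne_zero (L : 𝒜.lineBundles) (i : 𝒜.ι) : gen L i ≠ 0 := Units.ne_zero _

theorem gen_div_mem (L : 𝒜.lineBundles) {i j : 𝒜.ι} (h : i ≤ j) :
    gen L i / gen L j ∈ 𝒜.ring i ∧ gen L j / gen L i ∈ 𝒜.ring i := by
  have := L.2 i j h
  simpa [gen, toMul_sub, Units.val_div_eq_div_val] using this

/-- The coordinate ring `B[h t]`, `B[(h t)⁻¹]` or `B[h t, (h t)⁻¹]` of a chart of `ℙ(𝒪 ⊕ L)`, where
`B` is the coordinate ring of a chart of the base and `h` the generator of `L` there. -/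
def bundleRing (L : 𝒜.lineBundles) (t : Kˣ) (i : 𝒜.ι) (c : FiberChart) : Subalgebra ℂ K :=
  𝒜.ring i ⊔ Algebra.adjoin ℂ (FiberChart.coords (gen L i * t) c)

theorem bundleRing_eq (L : 𝒜.lineBundles) (t : Kˣ) {i j : 𝒜.ι} (h : i ≤ j) (c : FiberChart) :
    𝒜.bundleRing L t i c =
      𝒜.ring i ⊔ Algebra.adjoin ℂ (FiberChart.coords (gen L j * t) c) := by
  have ht : (t : K) ≠ 0 := t.ne_zero
  have hi := 𝒜.gen_ne_zero L i
  have hj := 𝒜.gen_ne_zero L j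
  obtain ⟨h1, h2⟩ := 𝒜.gen_div_mem L h
  refine FiberChart.adjoin_coords_eq ?_ ?_ (mul_ne_zero hi ht) (mul_ne_zero hj ht) c
  · rwa [mul_div_mul_right _ _ ht]
  · rwa [mul_div_mul_right _ _ ht]

theorem bundleRing_inf (L : 𝒜.lineBundles) (t : Kˣ) (i j : 𝒜.ι) (c e : FiberChart) :
    𝒜.bundleRing L t (i ⊓ j) (c ⊓ e) = 𝒜.bundleRing L t i c ⊔ 𝒜.bundleRing L t j e := by
  have hc : 𝒜.ring (i ⊓ j) ⊔ Algebra.adjoin ℂ (FiberChart.coords (gen L (i ⊓ j) * t) c) =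
      𝒜.ring (i ⊓ j) ⊔ Algebra.adjoin ℂ (FiberChart.coords (gen L i * t) c) :=
    𝒜.bundleRing_eq L t inf_le_left c
  have he : 𝒜.ring (i ⊓ j) ⊔ Algebra.adjoin ℂ (FiberChart.coords (gen L (i ⊓ j) * t) e) =
      𝒜.ring (i ⊓ j) ⊔ Algebra.adjoin ℂ (FiberChart.coords (gen L j * t) e) :=
    𝒜.bundleRing_eq L t inf_le_right e
  rw [bundleRing, FiberChart.coords_inf, Algebra.adjoin_union, sup_sup_distrib_left, hc, he,
    ← sup_sup_distrib_left, 𝒜.ring_inf, bundleRing, bundleRing, sup_sup_sup_comm]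

theorem bundleRing_away (L : 𝒜.lineBundles) (t : Kˣ) (i j : 𝒜.ι) (c e : FiberChart)
    (hij : i ≤ j) (hce : c ≤ e) :
    ∃ f : K, f ≠ 0 ∧ f ∈ 𝒜.bundleRing L t j e ∧ f⁻¹ ∈ 𝒜.bundleRing L t i c ∧
      ∀ x ∈ 𝒜.bundleRing L t i c, ∃ m : ℕ, f ^ m * x ∈ 𝒜.bundleRing L t j e := by
  obtain ⟨f, h0, hj, hi, hloc⟩ := 𝒜.exists_away i j hij
  have hu : gen L j * t ≠ 0 := mul_ne_zero (𝒜.gen_ne_zero L j) t.ne_zero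
  rw [𝒜.bundleRing_eq L t hij c, bundleRing]
  set u : K := gen L j * t
  set R := 𝒜.ring j ⊔ Algebra.adjoin ℂ (FiberChart.coords u e) with hRdef
  set S := 𝒜.ring i ⊔ Algebra.adjoin ℂ (FiberChart.coords u c) with hSdef
  have hR : ∀ x ∈ 𝒜.ring j, x ∈ R := fun x hx => (le_sup_left : _ ≤ R) hx
  have hRc : ∀ x ∈ FiberChart.coords u e, x ∈ R :=
    fun x hx => (le_sup_right : _ ≤ R) (Algebra.subset_adjoin hx)
  have hS : ∀ x ∈ 𝒜.ring i, x ∈ S := fun x hx => (le_sup_left : _ ≤ S) hx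
  have hSc : ∀ x ∈ FiberChart.coords u c, x ∈ S :=
    fun x hx => (le_sup_right : _ ≤ S) (Algebra.subset_adjoin hx)
  -- it is enough to invert `f * w` for a suitable `w`
  have key : ∀ w : K, w ≠ 0 → w ∈ R → w⁻¹ ∈ S →
      (∀ x ∈ FiberChart.coords u c, x ∈ R ∨ x = w⁻¹) →
      ∃ g : K, g ≠ 0 ∧ g ∈ R ∧ g⁻¹ ∈ S ∧ ∀ x ∈ S, ∃ m : ℕ, g ^ m * x ∈ R := by
    intro w hw hwR hwS hcov
    have hgR : f * w ∈ R := R.mul_mem (hR f hj) hwR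
    refine ⟨f * w, mul_ne_zero h0 hw, hgR, ?_, ?_⟩
    · rw [mul_inv]
      exact S.mul_mem (hS _ hi) hwS
    · have hle : S ≤ awaySubalgebra R (f * w) hgR := by
        refine sup_le (fun x hx => ?_) (Algebra.adjoin_le fun x hx => ?_)
        · obtain ⟨m, hm⟩ := hloc x hx
          refine ⟨m, ?_⟩
          have e1 : (f * w) ^ m * x = w ^ m * (f ^ m * x) := by ring
          rw [e1]
          exact R.mul_mem (R.pow_mem hwR m) (hR _ hm)
        · rcases hcov x hx with h | rfl
          · exact ⟨0, by simpa using h⟩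
          · refine ⟨1, ?_⟩
            have e1 : (f * w) ^ 1 * w⁻¹ = f := by field_simp
            rw [e1]
            exact hR f hj
      exact fun x hx => hle hx
  have hce' : c ⊓ e = c := inf_eq_left.mpr hce
  have same : c = e → ∃ g : K, g ≠ 0 ∧ g ∈ R ∧ g⁻¹ ∈ S ∧ ∀ x ∈ S, ∃ m : ℕ, g ^ m * x ∈ R := by
    intro h
    refine key 1 one_ne_zero R.one_mem (by simp [S.one_mem]) (fun x hx => Or.inl (hRc x ?_))
    rwa [← h]
  cases c <;> cases e
  · exact same rfl
  · exact absurd hce' (by intro h; cases h)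
  · exact absurd hce' (by intro h; cases h)
  · exact absurd hce' (by intro h; cases h)
  · exact same rfl
  · exact absurd hce' (by intro h; cases h)
  · refine key u hu (hRc u rfl) (hSc _ (Or.inr rfl)) ?_
    rintro x (rfl | hx)
    · exact Or.inl (hRc _ rfl)
    · exact Or.inr hx
  · refine key u⁻¹ (inv_ne_zero hu) (hRc _ rfl) (hSc _ (Or.inl (inv_inv u))) ?_
    rintro x (rfl | hx)
    · exact Or.inr (inv_inv _).symm
    · exact Or.inl (hRc _ hx)
  · exact same rfl

/-- The `ℙ¹`-bundle `ℙ(𝒪 ⊕ L) = Proj Sym(𝒪 ⊕ L)` of rank one quotients (equivalently, of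
hyperplanes) of `𝒪 ⊕ L`.  Here `t` is a variable over the function field of the base; it is the
rational function `e₂ / e₁`, where `e₁` is the section `1` of `𝒪` and `e₂` is the rational section
`1 ∈ K` of `L ⊆ K`.  If `L` is generated by `h` on a chart `Spec B` of the base, then `Sym(𝒪 ⊕ L)`
is there the polynomial ring `B[e₁, h e₂]`, and the charts over `Spec B` are
`Spec B[h t]` and `Spec B[(h t)⁻¹]`. -/
abbrev projBundle (L : 𝒜.lineBundles) (t : Kˣ) : Atlas K where
  ι := 𝒜.ι × FiberChart
  ring p := 𝒜.bundleRing L t p.1 p.2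
  ring_inf p q := 𝒜.bundleRing_inf L t p.1 q.1 p.2 q.2
  exists_away p q h := 𝒜.bundleRing_away L t p.1 q.1 p.2 q.2 h.1 h.2

/-- The local generators of the tautological quotient bundle `𝒪(1)` of `ℙ(𝒪 ⊕ L)`, embedded into
`K` by dividing by its section `e₁`: it is generated by `e₁` on the charts `B[h t]` and by
`h e₂` on the charts `B[(h t)⁻¹]`. -/
def tautologicalGen (L : 𝒜.lineBundles) (t : Kˣ) (i : 𝒜.ι) : FiberChart → Additive Kˣ
  | .fst => 0
  | .snd => L.1 i + Additive.ofMul t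
  | .both => 0

theorem tautologicalGen_mem (L : 𝒜.lineBundles) (t : Kˣ) (i j : 𝒜.ι) (c e : FiberChart)
    (hij : i ≤ j) (hce : c ≤ e) :
    ((𝒜.tautologicalGen L t i c - 𝒜.tautologicalGen L t j e).toMul : K) ∈
        𝒜.bundleRing L t i c ∧
      ((𝒜.tautologicalGen L t j e - 𝒜.tautologicalGen L t i c).toMul : K) ∈
        𝒜.bundleRing L t i c := by
  have hce' : c ⊓ e = c := inf_eq_left.mpr hce
  have hone := (𝒜.bundleRing L t i c).one_mem
  obtain ⟨h1, h2⟩ := 𝒜.gen_div_mem L hij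
  have hb : ∀ x ∈ 𝒜.ring i, x ∈ 𝒜.bundleRing L t i c := fun x hx =>
    (le_sup_left : 𝒜.ring i ≤ 𝒜.bundleRing L t i c) hx
  have hc : ∀ x ∈ FiberChart.coords (gen L j * t) c, x ∈ 𝒜.bundleRing L t i c := by
    intro x hx
    rw [𝒜.bundleRing_eq L t hij c]
    exact (le_sup_right : _ ≤ 𝒜.ring i ⊔ _) (Algebra.subset_adjoin hx)
  have z0 : (((0 : Additive Kˣ) - 0).toMul : K) = 1 := by simp
  cases c <;> cases e
  · exact ⟨by simpa only [tautologicalGen, z0] using hone,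
      by simpa only [tautologicalGen, z0] using hone⟩
  · exact absurd hce' (by intro h; cases h)
  · exact absurd hce' (by intro h; cases h)
  · exact absurd hce' (by intro h; cases h)
  · constructor
    · have e1 : L.1 i + Additive.ofMul t - (L.1 j + Additive.ofMul t) = L.1 i - L.1 j := by abel
      simp only [tautologicalGen, e1]
      exact hb _ (L.2 i j hij).1
    · have e1 : L.1 j + Additive.ofMul t - (L.1 i + Additive.ofMul t) = L.1 j - L.1 i := by abel
      simp only [tautologicalGen, e1]
      exact hb _ (L.2 i j hij).2
  · exact absurd hce' (by intro h; cases h)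
  · exact ⟨by simpa only [tautologicalGen, z0] using hone,
      by simpa only [tautologicalGen, z0] using hone⟩
  · constructor
    · have e1 : ((0 - (L.1 j + Additive.ofMul t)).toMul : K) = (gen L j * t)⁻¹ := by
        simp [gen, mul_comm]
      simp only [tautologicalGen, e1]
      exact hc _ (Or.inr rfl)
    · have e1 : (((L.1 j + Additive.ofMul t) - 0).toMul : K) = gen L j * t := by
        simp [gen]
      simp only [tautologicalGen, e1]
      exact hc _ (Or.inl rfl)
  · exact ⟨by simpa only [tautologicalGen, z0] using hone,
      by simpa only [tautologicalGen, z0] using hone⟩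

/-- The tautological line bundle `𝒪(1)` on `ℙ(𝒪 ⊕ L)`. -/
def tautological (L : 𝒜.lineBundles) (t : Kˣ) : (𝒜.projBundle L t).lineBundles :=
  ⟨fun p => 𝒜.tautologicalGen L t p.1 p.2,
    fun p q h => 𝒜.tautologicalGen_mem L t p.1 q.1 p.2 q.2 h.1 h.2⟩

/-- The pullback of line bundles from the base to `ℙ(𝒪 ⊕ L)`. -/
def pullback (L : 𝒜.lineBundles) (t : Kˣ) (D : 𝒜.lineBundles) :
    (𝒜.projBundle L t).lineBundles :=
  ⟨fun p => D.1 p.1, fun p q h =>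
    have hb : 𝒜.ring p.1 ≤ (𝒜.projBundle L t).ring p := le_sup_left
    ⟨hb (D.2 p.1 q.1 h.1).1, hb (D.2 p.1 q.1 h.1).2⟩⟩

end Atlas

/-! ### The threefold -/

/-- The function field `ℂ(z, y, x)` of the threefold. -/
abbrev FunField : Type := FractionRing (MvPolynomial (Fin 3) ℂ)

/-- The variables `z = coordVar 0`, `y = coordVar 1`, `x = coordVar 2`. -/
def coordVar (k : Fin 3) : FunFieldˣ :=
  Units.mk0 (algebraMap (MvPolynomial (Fin 3) ℂ) FunField (MvPolynomial.X k)) (by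
    rw [Ne, FaithfulSMul.algebraMap_eq_zero_iff]
    exact MvPolynomial.X_ne_zero k)

/-- The point `Spec ℂ`. -/
abbrev pointAtlas : Atlas FunField where
  ι := Unit
  ring _ := ⊥
  ring_inf _ _ := by simp
  exists_away _ _ _ := ⟨1, one_ne_zero, one_mem _, by simp [one_mem],
    fun x hx => ⟨0, by simpa using hx⟩⟩

/-- The projective line `ℙ¹ = ℙ(𝒪 ⊕ 𝒪)` over the point. -/
abbrev projLine : Atlas FunField := pointAtlas.projBundle 0 (coordVar 0)

/-- The line bundle `𝒪(1)` on `ℙ¹`. -/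
def projLineO1 : projLine.lineBundles := pointAtlas.tautological 0 (coordVar 0)

/-- The Segre-Hirzebruch surface `𝔽ₙ = ℙ(𝒪 ⊕ 𝒪(-n))` over `ℙ¹`. -/
abbrev hirzebruch (n : ℕ) : Atlas FunField := projLine.projBundle (-(n • projLineO1)) (coordVar 1)

/-- The class `F` of a fibre of `𝔽ₙ → ℙ¹`. -/
def hirzebruchF (n : ℕ) : (hirzebruch n).lineBundles :=
  projLine.pullback (-(n • projLineO1)) (coordVar 1) projLineO1

/-- The class of the negative section `C₀` of `𝔽ₙ`: the section `1` of the summand `𝒪` gives a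
section of `𝒪(1)` on `ℙ(𝒪 ⊕ 𝒪(-n))`, with zero divisor `C₀`, and `C₀² = -n`. -/
def hirzebruchC₀ (n : ℕ) : (hirzebruch n).lineBundles :=
  projLine.tautological (-(n • projLineO1)) (coordVar 1)

/-- The class `A = 2 C₀ - F` on `𝔽ₙ`. -/
def hirzebruchA (n : ℕ) : (hirzebruch n).lineBundles := 2 • hirzebruchC₀ n - hirzebruchF n

/-- The threefold `X = ℙ(𝒪 ⊕ 𝒪(-A))` over `𝔽ₙ`. -/
abbrev scroll (n : ℕ) : Atlas FunField := (hirzebruch n).projBundle (-hirzebruchA n) (coordVar 2)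

/-- The class `τ = c₁(𝒪_X(1))`. -/
def scrollτ (n : ℕ) : (scroll n).lineBundles :=
  (hirzebruch n).tautological (-hirzebruchA n) (coordVar 2)

/-- The pullback to `X` of a class on `𝔽ₙ`. -/
def scrollPullback (n : ℕ) (D : (hirzebruch n).lineBundles) : (scroll n).lineBundles :=
  (hirzebruch n).pullback (-hirzebruchA n) (coordVar 2) D

end

/-!
The threefold `X` is toric, and everything in sight is described by Laurent monomials
`zⁱ yʲ xᵏ` in its function field `ℂ(z, y, x)`: the coordinate ring of each chart is spanned by the
monomials with exponents in a cone (`mem_scroll_ring_iff`), and the local generators of all the line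
bundles involved are monomials (`gen_scrollτ` and its companions). Hence the global sections of
`γ τ + β C₀ + α F` are spanned by the monomials with `0 ≤ k ≤ γ`, `0 ≤ j`, `j + 2k ≤ β`, `0 ≤ i` and
`i + n j - k ≤ α` (`isSection_iff`).

* For `τ + A = τ + 2C₀ - F` the only such monomial is `x`, and for `C₀` it is `1`, because `n > 0`.
  So both systems have one member; `R` is `x = 0` and `U` is `y = ∞`. Members exist since the local
  equations of a section glue to an ideal sheaf (`Atlas.exists_isCutOutBy`).
* On each chart `R` and `U` are given by two different coordinates, or by a unit
  (`isWeaklyRegular_eqn`). On the charts that meet `σ = R ∩ U`, dividing by the two coordinates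
  leaves the functions of `z` alone, that is, the coordinate ring of a chart of `ℙ¹`
  (`exists_retraction_scroll`). Such retractions of coordinate rings glue to a section `ℙ¹ → X` of
  the projection `X → ℙ¹` whose image is `σ` (`Atlas.exists_iso_of_retraction`).
* The form `dz ∧ dy ∧ dx` has divisor `-(2τ + 4C₀ + (n+1)F)` (`regularForms_scroll`), so that
  `|-2K_X|` is the linear system of `4τ + 8C₀ + (2n+2)F` (`antiCanonicalSystem_scroll`). A monomial
  section of this bundle that is not divisible by `x` has `n j ≤ 2n + 2`, hence `j < 8`, and
  so it vanishes along `U`, with multiplicity `8 - j`: the base locus contains `σ`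
  (`eqn_mem_of_mem`). Conversely the sections `zⁱ x⁴` have no common zero outside `R`, and the
  sections `1`, `z²ⁿ⁺²`, `y²` and `z² y²` have no common zero on `R` outside `U`
  (`mem_of_forall_eqn_mem`).
-/

noncomputable section

/-! ### Ideal sheaves on affine schemes and open immersions -/

namespace Atlas

section IdealSheaves

variable {B C : Type} [CommRing B] [CommRing C]

theorem idealSheafOfIdeal_le_ker_iff (I : Ideal B) (ψ : B →+* C) :
    idealSheafOfIdeal I ≤ (Spec.map (CommRingCat.ofHom ψ)).ker ↔ I ≤ RingHom.ker ψ := by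
  constructor
  · intro h
    have hmk : IsClosedImmersion (Spec.map (CommRingCat.ofHom (Ideal.Quotient.mk I))) :=
      IsClosedImmersion.spec_of_surjective _ Ideal.Quotient.mk_surjective
    obtain ⟨χ, hχ⟩ := Spec.map_surjective
      (IsClosedImmersion.lift (Spec.map (CommRingCat.ofHom (Ideal.Quotient.mk I)))
        (Spec.map (CommRingCat.ofHom ψ)) h)
    have h2 := IsClosedImmersion.lift_fac (Spec.map (CommRingCat.ofHom (Ideal.Quotient.mk I)))
        (Spec.map (CommRingCat.ofHom ψ)) h
    rw [← hχ, ← Spec.map_comp] at h2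
    have h3 := Spec.map_injective h2
    intro x hx
    have h4 : ψ x = χ.hom (Ideal.Quotient.mk I x) := by
      have := congrArg (fun f => f.hom x) h3
      exact this.symm
    rw [RingHom.mem_ker, h4, Ideal.Quotient.eq_zero_iff_mem.mpr hx, map_zero]
  · intro h
    have hχ : (Ideal.Quotient.lift I ψ fun _ ha => RingHom.mem_ker.mp (h ha)).comp
        (Ideal.Quotient.mk I) = ψ := Ideal.Quotient.lift_comp_mk _ _ _
    have e := congrArg (fun f => Spec.map (CommRingCat.ofHom f)) hχ.symm
    simp only [CommRingCat.ofHom_comp, Spec.map_comp] at e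
    rw [e]
    exact Scheme.Hom.le_ker_comp _ _

theorem idealSheafOfIdeal_le_iff (I J : Ideal B) :
    idealSheafOfIdeal I ≤ idealSheafOfIdeal J ↔ I ≤ J := by
  rw [idealSheafOfIdeal, idealSheafOfIdeal, ← idealSheafOfIdeal, idealSheafOfIdeal_le_ker_iff,
    Ideal.mk_ker]

theorem idealSheafOfIdeal_injective :
    Function.Injective (idealSheafOfIdeal (B := B)) := fun I J h =>
  le_antisymm ((idealSheafOfIdeal_le_iff I J).mp h.le) ((idealSheafOfIdeal_le_iff J I).mp h.ge)

/-- Closed subschemes of an affine scheme are given by ideals. -/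
theorem idealSheafOfIdeal_surjective :
    Function.Surjective (idealSheafOfIdeal (B := B)) := by
  intro Z
  have hZ : IsClosedImmersion Z.subschemeι := inferInstance
  obtain ⟨I, e, he⟩ := IsClosedImmersion.Spec_iff.mp hZ
  change Ideal B at I
  refine ⟨I, ?_⟩
  rw [idealSheafOfIdeal, ← Scheme.Hom.ker_comp_of_isIso e.hom]
  exact (congrArg Scheme.Hom.ker he.symm).trans Z.ker_subschemeι

/-- Pullback of ideal sheaves along a morphism of affine schemes is extension of ideals. -/
theorem comap_idealSheafOfIdeal (I : Ideal B) (φ : B →+* C) :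
    (idealSheafOfIdeal I).comap (Spec.map (CommRingCat.ofHom φ)) = idealSheafOfIdeal (I.map φ) := by
  have key : ∀ J : Ideal C, (idealSheafOfIdeal I).comap (Spec.map (CommRingCat.ofHom φ)) ≤
      idealSheafOfIdeal J ↔ I.map φ ≤ J := by
    intro J
    rw [← Scheme.IdealSheafData.le_map_iff_comap_le, idealSheafOfIdeal.eq_1 J,
      Scheme.IdealSheafData.map_ker, ← Spec.map_comp, ← CommRingCat.ofHom_comp,
      idealSheafOfIdeal_le_ker_iff, ← RingHom.comap_ker, Ideal.mk_ker, Ideal.map_le_iff_le_comap]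
  obtain ⟨J, hJ⟩ := idealSheafOfIdeal_surjective
    ((idealSheafOfIdeal I).comap (Spec.map (CommRingCat.ofHom φ)))
  apply le_antisymm
  · exact (key _).mpr le_rfl
  · rw [← hJ, idealSheafOfIdeal_le_iff]
    exact (key J).mp hJ.ge

theorem idealSheafOfIdeal_top : idealSheafOfIdeal (⊤ : Ideal B) = ⊤ := by
  obtain ⟨J, hJ⟩ := idealSheafOfIdeal_surjective (⊤ : (Spec (CommRingCat.of B)).IdealSheafData)
  refine top_le_iff.mp ?_
  rw [← hJ, idealSheafOfIdeal_le_iff]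
  exact le_top

theorem idealSheafOfIdeal_bot : idealSheafOfIdeal (⊥ : Ideal B) = ⊥ := by
  obtain ⟨J, hJ⟩ := idealSheafOfIdeal_surjective (⊥ : (Spec (CommRingCat.of B)).IdealSheafData)
  refine le_bot_iff.mp ?_
  rw [← hJ, idealSheafOfIdeal_le_iff]
  exact bot_le

theorem idealSheafOfIdeal_sup (I J : Ideal B) :
    idealSheafOfIdeal (I ⊔ J) = idealSheafOfIdeal I ⊔ idealSheafOfIdeal J := by
  obtain ⟨L, hL⟩ := idealSheafOfIdeal_surjective (idealSheafOfIdeal I ⊔ idealSheafOfIdeal J)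
  apply le_antisymm
  · rw [← hL, idealSheafOfIdeal_le_iff]
    refine sup_le ?_ ?_ <;> rw [← idealSheafOfIdeal_le_iff, hL]
    exacts [le_sup_left, le_sup_right]
  · refine sup_le ?_ ?_ <;> rw [idealSheafOfIdeal_le_iff]
    exacts [le_sup_left, le_sup_right]

theorem mem_support_idealSheafOfIdeal (I : Ideal B) (p : Spec (CommRingCat.of B)) :
    p ∈ (idealSheafOfIdeal I).support ↔ I ≤ PrimeSpectrum.asIdeal p := by
  have hmk : IsClosedImmersion (Spec.map (CommRingCat.ofHom (Ideal.Quotient.mk I))) :=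
    IsClosedImmersion.spec_of_surjective _ Ideal.Quotient.mk_surjective
  rw [← SetLike.mem_coe, idealSheafOfIdeal, Scheme.Hom.support_ker,
    (Scheme.Hom.isClosedEmbedding _).isClosed_range.closure_eq]
  have := range_comap_of_surjective _ (Ideal.Quotient.mk I)
    Ideal.Quotient.mk_surjective
  change p ∈ Set.range (PrimeSpectrum.comap (Ideal.Quotient.mk I)) ↔ _
  rw [this, Ideal.mk_ker]
  exact Iff.rfl

/-- The kernel of a quasi-compact morphism commutes with base change along open immersions. -/
theorem comap_ker_of_isOpenImmersion {X Y U : Scheme.{0}} (f : X ⟶ Y) (ι : U ⟶ Y)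
    [IsOpenImmersion ι] [QuasiCompact f] : f.ker.comap ι = (pullback.fst ι f).ker := by
  refine Scheme.IdealSheafData.ext (funext fun W => ?_)
  rw [Scheme.IdealSheafData.ideal_comap_of_isOpenImmersion,
    Scheme.ker_ideal_of_isPullback_of_isOpenImmersion f (pullback.fst ι f) (pullback.snd ι f) ι
      (IsPullback.of_hasPullback ι f)]

theorem comap_iInf_of_isOpenImmersion {Y U : Scheme.{0}} {ι : Type} [Finite ι]
    (I : ι → Y.IdealSheafData) (f : U ⟶ Y) [IsOpenImmersion f] :
    (⨅ i, I i).comap f = ⨅ i, (I i).comap f := by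
  refine Scheme.IdealSheafData.ext (funext fun W => ?_)
  rw [Scheme.IdealSheafData.ideal_comap_of_isOpenImmersion, Scheme.IdealSheafData.ideal_iInf,
    Scheme.IdealSheafData.ideal_iInf, iInf_apply, iInf_apply, Ideal.comap_iInf]
  simp only [Scheme.IdealSheafData.ideal_comap_of_isOpenImmersion]

end IdealSheaves

variable {K : Type} [Field K] [Algebra ℂ K] (𝒜 : Atlas K)

/-! ### Charts of the glued scheme -/

instance isOpenImmersion_chart (i : 𝒜.ι) : IsOpenImmersion (𝒜.chart i) :=
  inferInstanceAs (IsOpenImmersion (colimit.ι 𝒜.diagram i))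

theorem exists_chart_eq (x : 𝒜.toScheme) : ∃ (i : 𝒜.ι) (p : _), 𝒜.chart i p = x :=
  Scheme.IsLocallyDirected.ι_jointly_surjective 𝒜.diagram x

/-- The restriction of functions from the chart `j` to the smaller chart `i`. -/
def res {i j : 𝒜.ι} (h : i ≤ j) : 𝒜.ring j →+* 𝒜.ring i :=
  (Subalgebra.inclusion (𝒜.ring_anti h)).toRingHom

@[simp]
theorem coe_res {i j : 𝒜.ι} (h : i ≤ j) (a : 𝒜.ring j) : (𝒜.res h a : K) = a := rfl

theorem spec_res_chart {i j : 𝒜.ι} (h : i ≤ j) :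
    Spec.map (CommRingCat.ofHom (𝒜.res h)) ≫ 𝒜.chart j = 𝒜.chart i :=
  colimit.w 𝒜.diagram (homOfLE h)

/-- The charts of `i` and `j` meet in the chart of `i ⊓ j`. -/
theorem exists_of_chart_eq_chart {i j : 𝒜.ι} {p : Spec (CommRingCat.of (𝒜.ring i))}
    {q : Spec (CommRingCat.of (𝒜.ring j))} (h : 𝒜.chart i p = 𝒜.chart j q) :
    𝒜.chart i p ∈ Set.range (𝒜.chart (i ⊓ j)) := by
  obtain ⟨k, fi, fj, x, hx, -⟩ :=
    (Scheme.IsLocallyDirected.ι_eq_ι_iff 𝒜.diagram).mp h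
  have hk : k ≤ i ⊓ j := le_inf fi.le fj.le
  change Spec (CommRingCat.of (𝒜.ring k)) at x
  change Spec.map (CommRingCat.ofHom (𝒜.res fi.le)) x = p at hx
  refine ⟨Spec.map (CommRingCat.ofHom (𝒜.res hk)) x, ?_⟩
  rw [← Scheme.Hom.comp_apply, 𝒜.spec_res_chart, ← hx, ← Scheme.Hom.comp_apply,
    𝒜.spec_res_chart]

/-- The cover of the glued scheme by its charts. -/
def chartCover : 𝒜.toScheme.OpenCover := Scheme.IsLocallyDirected.openCover 𝒜.diagram

/-- The fibre product of two charts is affine, namely the chart of their meet. In particular the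
charts are quasi-compact morphisms. -/
theorem isPullback_chart (i j : 𝒜.ι) :
    IsPullback (Spec.map (CommRingCat.ofHom (𝒜.res (inf_le_left : i ⊓ j ≤ i))))
      (Spec.map (CommRingCat.ofHom (𝒜.res (inf_le_right : i ⊓ j ≤ j))))
      (𝒜.chart i) (𝒜.chart j) := by
  have hr : ∀ s : PullbackCone (𝒜.chart i) (𝒜.chart j),
      Set.range (s.fst ≫ 𝒜.chart i) ⊆ Set.range (𝒜.chart (i ⊓ j)) := by
    rintro s _ ⟨x, rfl⟩
    have := congrArg (fun f => f x) s.condition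
    exact 𝒜.exists_of_chart_eq_chart this
  refine ⟨⟨by rw [spec_res_chart, spec_res_chart]⟩, ⟨PullbackCone.IsLimit.mk _
    (fun s => IsOpenImmersion.lift (𝒜.chart (i ⊓ j)) (s.fst ≫ 𝒜.chart i) (hr s)) ?_ ?_ ?_⟩⟩
  · intro s
    rw [← cancel_mono (𝒜.chart i), Category.assoc, spec_res_chart, IsOpenImmersion.lift_fac]
  · intro s
    rw [← cancel_mono (𝒜.chart j), Category.assoc, spec_res_chart, IsOpenImmersion.lift_fac,
      s.condition]
  · intro s m h1 h2
    rw [← cancel_mono (𝒜.chart (i ⊓ j)), IsOpenImmersion.lift_fac, ← h1, Category.assoc,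
      spec_res_chart]

instance quasiCompact_chart (i : 𝒜.ι) : QuasiCompact (𝒜.chart i) := by
  have hP : IsZariskiLocalAtTarget (@QuasiCompact : MorphismProperty Scheme.{0}) :=
    @HasAffineProperty.instIsZariskiLocalAtTarget _ _
      instHasAffinePropertyQuasiCompactCompactSpaceCarrierCarrierCommRingCat
  refine IsZariskiLocalAtTarget.of_openCover (P := (@QuasiCompact : MorphismProperty Scheme.{0}))
    𝒜.chartCover fun j => ?_
  have h := 𝒜.isPullback_chart i j
  change QuasiCompact (pullback.snd (𝒜.chart i) (𝒜.chart j))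
  rw [← h.isoPullback_inv_snd]
  infer_instance

/-! ### Ideal sheaves on the glued scheme -/

variable {𝒜} in
/-- Inclusions of ideal sheaves may be checked on the charts, whose images are affine open sets
covering the glued scheme. -/
theorem le_of_comap_chart_le {Z W : 𝒜.toScheme.IdealSheafData}
    (h : ∀ i, Z.comap (𝒜.chart i) ≤ W.comap (𝒜.chart i)) : Z ≤ W := by
  refine Scheme.IdealSheafData.le_of_iSup_eq_top
    (fun i : 𝒜.ι => ⟨(𝒜.chart i).opensRange, isAffineOpen_opensRange _⟩) ?_ ?_
  · refine top_le_iff.mp fun x _ => ?_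
    obtain ⟨i, p, rfl⟩ := 𝒜.exists_chart_eq x
    exact TopologicalSpace.Opens.mem_iSup.mpr ⟨i, p, rfl⟩
  · intro i
    have := h i ⟨⊤, isAffineOpen_top _⟩
    rw [Scheme.IdealSheafData.ideal_comap_of_isOpenImmersion,
      Scheme.IdealSheafData.ideal_comap_of_isOpenImmersion] at this
    have hs : Function.Surjective (((𝒜.chart i).appIso ⊤).inv.hom) :=
      (ConcreteCategory.bijective_of_isIso ((𝒜.chart i).appIso ⊤).inv).2
    have h3 := (Ideal.comap_le_comap_iff_of_surjective _ hs _ _).mp this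
    have e : (⟨(𝒜.chart i).opensRange, isAffineOpen_opensRange _⟩ : 𝒜.toScheme.affineOpens) =
        ⟨(𝒜.chart i) ''ᵁ ⊤, (isAffineOpen_top _).image_of_isOpenImmersion _⟩ :=
      Subtype.ext (Scheme.Hom.image_top_eq_opensRange _).symm
    rw [e]
    exact h3

variable {𝒜} in
theorem ext_of_comap_chart {Z W : 𝒜.toScheme.IdealSheafData}
    (h : ∀ i, Z.comap (𝒜.chart i) = W.comap (𝒜.chart i)) : Z = W :=
  le_antisymm (le_of_comap_chart_le fun i => (h i).le) (le_of_comap_chart_le fun i => (h i).ge)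

variable {𝒜} in
theorem IsCutOutBy.unique {Z W : 𝒜.toScheme.IdealSheafData} {I : ∀ i, Ideal (𝒜.ring i)}
    (hZ : 𝒜.IsCutOutBy Z I) (hW : 𝒜.IsCutOutBy W I) : Z = W :=
  ext_of_comap_chart fun i => (hZ i).trans (hW i).symm

/-- Ideals on the charts which are compatible with restriction glue to an ideal sheaf, namely
to the intersection of the ideal sheaves of the closures of the local closed subschemes. -/
theorem exists_isCutOutBy [Finite 𝒜.ι] (I : ∀ i, Ideal (𝒜.ring i))
    (hI : ∀ i j (h : i ≤ j), (I j).map (𝒜.res h) = I i) :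
    ∃ Z, 𝒜.IsCutOutBy Z I := by
  have hI' : ∀ i j (h : i ≤ j), (idealSheafOfIdeal (I j)).comap
      (Spec.map (CommRingCat.ofHom (𝒜.res h))) = idealSheafOfIdeal (I i) := by
    intro i j h
    rw [← hI i j h]
    exact comap_idealSheafOfIdeal _ _
  refine ⟨⨅ i, (idealSheafOfIdeal (I i)).map (𝒜.chart i), fun j => ?_⟩
  rw [comap_iInf_of_isOpenImmersion]
  apply le_antisymm
  · exact (iInf_le _ j).trans (Scheme.IdealSheafData.comap_map_le _ _)
  · refine le_iInf fun i => ?_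
    rw [idealSheafOfIdeal.eq_1 (I i), Scheme.IdealSheafData.map_ker, comap_ker_of_isOpenImmersion]
    set m := Spec.map (CommRingCat.ofHom (Ideal.Quotient.mk (I i)))
    -- the fibre product maps to the intersection of the charts
    have hp := 𝒜.isPullback_chart i j
    let P := Limits.pullback (𝒜.chart j) (m ≫ 𝒜.chart i)
    let q : P ⟶ Spec (CommRingCat.of (𝒜.ring (i ⊓ j))) :=
      hp.lift (pullback.snd _ _ ≫ m) (pullback.fst _ _)
        (by rw [Category.assoc]; exact pullback.condition.symm)
    have hq1 : q ≫ Spec.map (CommRingCat.ofHom (𝒜.res inf_le_left)) = pullback.snd _ _ ≫ m :=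
      hp.lift_fst _ _ _
    have hq2 : q ≫ Spec.map (CommRingCat.ofHom (𝒜.res inf_le_right)) = pullback.fst _ _ :=
      hp.lift_snd _ _ _
    rw [← hq2, ← Scheme.IdealSheafData.map_ker, Scheme.IdealSheafData.le_map_iff_comap_le,
      hI', ← hI' (i ⊓ j) i inf_le_left, ← Scheme.IdealSheafData.le_map_iff_comap_le,
      Scheme.IdealSheafData.map_ker, hq1]
    exact Scheme.Hom.le_ker_comp _ _

variable {𝒜} in
theorem IsCutOutBy.mem_support_iff {Z : 𝒜.toScheme.IdealSheafData} {I : ∀ i, Ideal (𝒜.ring i)}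
    (hZ : 𝒜.IsCutOutBy Z I) (i : 𝒜.ι) (p : Spec (CommRingCat.of (𝒜.ring i))) :
    𝒜.chart i p ∈ Z.support ↔ I i ≤ PrimeSpectrum.asIdeal p := by
  rw [← mem_support_idealSheafOfIdeal, ← hZ i, Scheme.IdealSheafData.support_comap]
  exact Iff.rfl

variable {𝒜} in
theorem IsCutOutBy.sup {Z W : 𝒜.toScheme.IdealSheafData} {I J : ∀ i, Ideal (𝒜.ring i)}
    (hZ : 𝒜.IsCutOutBy Z I) (hW : 𝒜.IsCutOutBy W J) :
    𝒜.IsCutOutBy (Z ⊔ W) fun i => I i ⊔ J i := fun i => by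
  rw [Scheme.IdealSheafData.comap_sup, hZ i, hW i, idealSheafOfIdeal_sup]

end Atlas

namespace Atlas

variable {K : Type} [Field K] [Algebra ℂ K] (𝒜 : Atlas K)

/-! ### Zero schemes of sections -/

variable {𝒜} in
theorem IsCutOutBy.map_res {Z : 𝒜.toScheme.IdealSheafData} {I : ∀ i, Ideal (𝒜.ring i)}
    (hZ : 𝒜.IsCutOutBy Z I) {i j : 𝒜.ι} (h : i ≤ j) : (I j).map (𝒜.res h) = I i := by
  apply idealSheafOfIdeal_injective
  rw [← comap_idealSheafOfIdeal, ← hZ j, ← hZ i, ← Scheme.IdealSheafData.comap_comp,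
    spec_res_chart]

variable {𝒜} in
/-- The local equation `s / gen D i` on the chart `i` of the zero scheme of a section `s`. -/
def IsSection.eqn {D : 𝒜.lineBundles} {s : K} (hs : IsSection D s) (i : 𝒜.ι) : 𝒜.ring i :=
  ⟨s / gen D i, hs i⟩

variable {𝒜} in
theorem IsSection.coe_eqn {D : 𝒜.lineBundles} {s : K} (hs : IsSection D s) (i : 𝒜.ι) :
    (hs.eqn i : K) = s / gen D i := rfl

variable {𝒜} in
theorem IsSection.span_eq {D : 𝒜.lineBundles} {s : K} (hs : IsSection D s) (i : 𝒜.ι) :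
    Ideal.span {a : 𝒜.ring i | (a : K) = s / gen D i} = Ideal.span {hs.eqn i} := by
  congr 1
  ext a
  exact ⟨fun h => Subtype.ext h, fun h => congrArg Subtype.val h⟩

variable {𝒜} in
theorem IsSection.exists_isCutOutBy [Finite 𝒜.ι] {D : 𝒜.lineBundles} {s : K}
    (hs : IsSection D s) :
    ∃ Z, 𝒜.IsCutOutBy Z fun i => Ideal.span {a : 𝒜.ring i | (a : K) = s / gen D i} := by
  refine 𝒜.exists_isCutOutBy _ fun i j h => ?_
  rw [hs.span_eq, hs.span_eq, Ideal.map_span, Set.image_singleton]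
  obtain ⟨h1, h2⟩ := 𝒜.gen_div_mem D h
  have hi := 𝒜.gen_ne_zero D i
  have hj := 𝒜.gen_ne_zero D j
  apply le_antisymm <;> rw [Ideal.span_singleton_le_span_singleton]
  · exact ⟨⟨_, h1⟩, Subtype.ext (by simp [eqn]; field_simp)⟩
  · exact ⟨⟨_, h2⟩, Subtype.ext (by simp [eqn]; field_simp)⟩

variable {𝒜} in
/-- If the global sections of `𝒪(D)` are the scalar multiples of a single one, then `|D|` has
exactly one member. -/
theorem exists_linearSystem_eq_singleton [Finite 𝒜.ι] {D : 𝒜.lineBundles} {s : K}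
    (hs : IsSection D s) (hs0 : s ≠ 0) (h : ∀ s', IsSection D s' → ∃ c : ℂ, s' = c • s) :
    ∃ Z, 𝒜.IsCutOutBy Z (fun i => Ideal.span {hs.eqn i}) ∧ linearSystem D = {Z} := by
  obtain ⟨Z, hZ⟩ := hs.exists_isCutOutBy
  have hZ' : 𝒜.IsCutOutBy Z (fun i => Ideal.span {hs.eqn i}) := fun i =>
    (hZ i).trans (congrArg _ (hs.span_eq i))
  refine ⟨Z, hZ', Set.eq_singleton_iff_unique_mem.mpr ⟨⟨s, hs0, hs, hZ⟩, ?_⟩⟩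
  rintro W ⟨s', hs'0, hs', hW⟩
  refine hW.unique fun i => ?_
  refine (hZ' i).trans (congrArg idealSheafOfIdeal ?_)
  beta_reduce
  rw [hs'.span_eq]
  obtain ⟨c, rfl⟩ := h s' hs'
  have hc : c ≠ 0 := by
    rintro rfl
    exact hs'0 (zero_smul _ _)
  apply le_antisymm <;> rw [Ideal.span_singleton_le_span_singleton]
  · refine ⟨algebraMap ℂ _ c⁻¹, Subtype.ext ?_⟩
    change s / gen D i = c • s / gen D i * algebraMap ℂ K c⁻¹
    rw [mul_comm, ← Algebra.smul_def, smul_div_assoc, inv_smul_smul₀ hc]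
  · refine ⟨algebraMap ℂ _ c, Subtype.ext ?_⟩
    change c • s / gen D i = s / gen D i * algebraMap ℂ K c
    rw [mul_comm, ← Algebra.smul_def, smul_div_assoc]

variable {𝒜} in
/-- A point of a chart is a base point of `|D|` iff the local equations of all sections of `𝒪(D)`
vanish there; the zero section does no harm. -/
theorem chart_mem_baseLocus_linearSystem [Finite 𝒜.ι] (D : 𝒜.lineBundles) (i : 𝒜.ι)
    (p : Spec (CommRingCat.of (𝒜.ring i))) :
    𝒜.chart i p ∈ baseLocus (linearSystem D) ↔
      ∀ s (hs : IsSection D s), hs.eqn i ∈ PrimeSpectrum.asIdeal p := by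
  rw [baseLocus, Set.mem_iInter₂]
  constructor
  · intro h s hs
    by_cases hs0 : s = 0
    · have e : hs.eqn i = 0 := Subtype.ext (by simp [IsSection.eqn, hs0])
      rw [e]
      exact Ideal.zero_mem _
    · obtain ⟨Z, hZ⟩ := hs.exists_isCutOutBy
      have := (hZ.mem_support_iff i p).mp (h Z ⟨s, hs0, hs, hZ⟩)
      rw [hs.span_eq] at this
      exact this (Ideal.mem_span_singleton_self _)
  · rintro h Z ⟨s, -, hs, hZ⟩
    refine (hZ.mem_support_iff i p).mpr ?_
    rw [hs.span_eq, Ideal.span_singleton_le_iff_mem]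
    exact h s hs

/-! ### Morphisms defined on charts -/

/-- Morphisms on the charts which are compatible with restriction glue. -/
def desc {Y : Scheme.{0}} (g : ∀ i, Spec (CommRingCat.of (𝒜.ring i)) ⟶ Y)
    (h : ∀ i j (hij : i ≤ j), Spec.map (CommRingCat.ofHom (𝒜.res hij)) ≫ g j = g i) :
    𝒜.toScheme ⟶ Y :=
  colimit.desc 𝒜.diagram
    { pt := Y
      ι :=
        { app := g
          naturality := fun i j f => (h i j f.le).trans (Category.comp_id _).symm } }

theorem chart_desc {Y : Scheme.{0}} (g : ∀ i, Spec (CommRingCat.of (𝒜.ring i)) ⟶ Y)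
    (h : ∀ i j (hij : i ≤ j), Spec.map (CommRingCat.ofHom (𝒜.res hij)) ≫ g j = g i) (i : 𝒜.ι) :
    𝒜.chart i ≫ 𝒜.desc g h = g i :=
  colimit.ι_desc (F := 𝒜.diagram) _ i

variable {𝒜} in
theorem hom_ext_chart {Y : Scheme.{0}} {f g : 𝒜.toScheme ⟶ Y}
    (h : ∀ i, 𝒜.chart i ≫ f = 𝒜.chart i ≫ g) : f = g := colimit.hom_ext h

theorem chart_structureMap (i : 𝒜.ι) : 𝒜.chart i ≫ 𝒜.structureMap =
    Spec.map (CommRingCat.ofHom (algebraMap ℂ (𝒜.ring i))) :=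
  colimit.ι_desc (F := 𝒜.diagram) _ i

theorem spec_map_comp {A B C : Type} [CommRing A] [CommRing B] [CommRing C] (f : A →+* B)
    (g : B →+* C) : Spec.map (CommRingCat.ofHom g) ≫ Spec.map (CommRingCat.ofHom f) =
      Spec.map (CommRingCat.ofHom (g.comp f)) := by
  rw [CommRingCat.ofHom_comp, Spec.map_comp]

section Retraction

variable {𝒜} {ℬ : Atlas K}

/-- The morphism of glued schemes given by inclusions of coordinate rings. -/
def proj (r : 𝒜.ι → ℬ.ι) (hr : Monotone r)
    (hring : ∀ i, ℬ.ring (r i) ≤ 𝒜.ring i) : 𝒜.toScheme ⟶ ℬ.toScheme :=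
  𝒜.desc (fun i => Spec.map (CommRingCat.ofHom (Subalgebra.inclusion (hring i)).toRingHom) ≫
    ℬ.chart (r i)) (by
      intro i j hij
      rw [← ℬ.spec_res_chart (hr hij), ← Category.assoc, ← Category.assoc, spec_map_comp,
        spec_map_comp]
      rfl)

/-- On a chart, `proj` may be computed with any larger chart of the target. -/
theorem chart_proj (r : 𝒜.ι → ℬ.ι) (hr : Monotone r)
    (hring : ∀ i, ℬ.ring (r i) ≤ 𝒜.ring i)
    (i : 𝒜.ι) (k : ℬ.ι) (hk : r i ≤ k) :
    𝒜.chart i ≫ proj r hr hring = Spec.map (CommRingCat.ofHom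
      (Subalgebra.inclusion ((ℬ.ring_anti hk).trans (hring i))).toRingHom) ≫ ℬ.chart k := by
  rw [proj, chart_desc, ← ℬ.spec_res_chart hk, ← Category.assoc, spec_map_comp]
  rfl

theorem proj_structureMap (r : 𝒜.ι → ℬ.ι) (hr : Monotone r)
    (hring : ∀ i, ℬ.ring (r i) ≤ 𝒜.ring i) :
    proj r hr hring ≫ ℬ.structureMap = 𝒜.structureMap := by
  refine hom_ext_chart fun i => ?_
  rw [← Category.assoc, chart_proj r hr hring i _ le_rfl, Category.assoc, chart_structureMap,
    chart_structureMap, spec_map_comp]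
  rfl

/-- Let `𝒜 → ℬ` be given by inclusions of coordinate rings.  A closed subscheme of `𝒜` which
is contained in the charts `s k` and there cut out by the kernel of a retraction
`𝒜.ring (s k) → ℬ.ring k` maps isomorphically to `ℬ`. -/
theorem exists_iso_of_retraction (r : 𝒜.ι → ℬ.ι) (hr : Monotone r)
    (hring : ∀ i, ℬ.ring (r i) ≤ 𝒜.ring i)
    (s : ℬ.ι → 𝒜.ι) (hs : Monotone s) (hrs : ∀ k, r (s k) ≤ k)
    (ρ : ∀ k, 𝒜.ring (s k) →+* ℬ.ring k)
    (hρ : ∀ k (b : ℬ.ring k) (a : 𝒜.ring (s k)), (a : K) = b → ρ k a = b)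
    {Z : 𝒜.toScheme.IdealSheafData} {J : ∀ i, Ideal (𝒜.ring i)} (hZ : 𝒜.IsCutOutBy Z J)
    (hJ : ∀ k, J (s k) = RingHom.ker (ρ k)) (hJ' : ∀ i, (∃ k, i = s k) ∨ J i = ⊤) :
    ∃ e : Z.subscheme ≅ ℬ.toScheme,
      e.hom ≫ ℬ.structureMap = Z.subschemeι ≫ 𝒜.structureMap := by
  have hle : ∀ k, ℬ.ring k ≤ 𝒜.ring (s k) := fun k =>
    (ℬ.ring_anti (hrs k)).trans (hring (s k))
  let inc : ∀ k, ℬ.ring k →+* 𝒜.ring (s k) := fun k => (Subalgebra.inclusion (hle k)).toRingHom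
  have hinc : ∀ k b, ((inc k b : 𝒜.ring (s k)) : K) = b := fun _ _ => rfl
  have hρinc : ∀ k, (ρ k).comp (inc k) = RingHom.id _ := fun k =>
    RingHom.ext fun b => hρ k b _ (hinc k b)
  have hincρ : ∀ k a, a - inc k (ρ k a) ∈ J (s k) := by
    intro k a
    rw [hJ, RingHom.mem_ker, map_sub, ← RingHom.comp_apply (ρ k), hρinc, RingHom.id_apply, sub_self]
  -- the section of the projection
  let f : ℬ.toScheme ⟶ 𝒜.toScheme :=
    ℬ.desc (fun k => Spec.map (CommRingCat.ofHom (ρ k)) ≫ 𝒜.chart (s k)) (by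
      intro k l hkl
      rw [← 𝒜.spec_res_chart (hs hkl), ← Category.assoc, ← Category.assoc, spec_map_comp,
        spec_map_comp]
      congr 3
      ext1 a
      have h1 := Ideal.mem_map_of_mem (𝒜.res (hs hkl)) (hincρ l a)
      rw [hZ.map_res (hs hkl), hJ, RingHom.mem_ker, map_sub, map_sub, sub_eq_zero] at h1
      exact ((hρ k (ℬ.res hkl (ρ l a)) (𝒜.res (hs hkl) (inc l (ρ l a))) rfl).symm.trans
        h1.symm))
  have hf : ∀ k, ℬ.chart k ≫ f = Spec.map (CommRingCat.ofHom (ρ k)) ≫ 𝒜.chart (s k) :=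
    fun k => ℬ.chart_desc _ _ k
  let π := proj r hr hring
  have hπ : ∀ k, 𝒜.chart (s k) ≫ π = Spec.map (CommRingCat.ofHom (inc k)) ≫ ℬ.chart k :=
    fun k => chart_proj r hr hring (s k) k (hrs k)
  have hfπ : f ≫ π = 𝟙 _ := by
    refine hom_ext_chart fun k => ?_
    rw [← Category.assoc, hf, Category.assoc, hπ, ← Category.assoc, spec_map_comp, hρinc,
      CommRingCat.ofHom_id, Spec.map_id, Category.id_comp, Category.comp_id]
  -- `f` factors through the closed subscheme
  have hZf : Z.subschemeι.ker ≤ f.ker := by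
    rw [Scheme.IdealSheafData.ker_subschemeι, ← Scheme.IdealSheafData.map_bot,
      Scheme.IdealSheafData.le_map_iff_comap_le]
    refine le_of_comap_chart_le fun k => ?_
    rw [← Scheme.IdealSheafData.comap_comp, hf, Scheme.IdealSheafData.comap_comp, hZ,
      comap_idealSheafOfIdeal, hJ, Scheme.IdealSheafData.comap_bot]
    rw [(Ideal.map_eq_bot_iff_le_ker (ρ k)).mpr le_rfl, idealSheafOfIdeal_bot]
  let g := IsClosedImmersion.lift Z.subschemeι f hZf
  have hg : g ≫ Z.subschemeι = f := IsClosedImmersion.lift_fac _ _ _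
  -- on the closed subscheme, projecting to `ℬ` and coming back is the identity
  have hZπf : Z.subschemeι ≫ π ≫ f = Z.subschemeι := by
    refine Scheme.Cover.hom_ext (𝒜.chartCover.pullback₁ Z.subschemeι) _ _ fun i => ?_
    change Limits.pullback.fst Z.subschemeι (𝒜.chart i) ≫ _ =
      Limits.pullback.fst Z.subschemeι (𝒜.chart i) ≫ _
    rw [← Category.assoc, Limits.pullback.condition, Category.assoc]
    set q := Limits.pullback.snd Z.subschemeι (𝒜.chart i)
    have hq : idealSheafOfIdeal (J i) ≤ q.ker := by
      rw [← hZ i, ← Scheme.IdealSheafData.le_map_iff_comap_le, Scheme.IdealSheafData.map_ker,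
        ← Limits.pullback.condition]
      exact (Scheme.IdealSheafData.ker_subschemeι Z).ge.trans (Scheme.Hom.le_ker_comp _ _)
    rcases hJ' i with ⟨k, rfl⟩ | h
    · have hmk : IsClosedImmersion (Spec.map (CommRingCat.ofHom (Ideal.Quotient.mk (J (s k))))) :=
        IsClosedImmersion.spec_of_surjective _ Ideal.Quotient.mk_surjective
      rw [← IsClosedImmersion.lift_fac _ q hq, Category.assoc, Category.assoc]
      congr 1
      rw [← Category.assoc (𝒜.chart (s k)), hπ, Category.assoc, hf, ← Category.assoc,
        ← Category.assoc, spec_map_comp, spec_map_comp]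
      congr 3
      ext1 a
      refine (Ideal.Quotient.eq.mpr ?_).symm
      exact hincρ k a
    · rw [h, idealSheafOfIdeal_top, top_le_iff, Scheme.Hom.ker_eq_top_iff_isEmpty] at hq
      exact (isInitialOfIsEmpty (X := Limits.pullback Z.subschemeι (𝒜.chart i))).hom_ext _ _
  refine ⟨⟨Z.subschemeι ≫ π, g, ?_, ?_⟩, ?_⟩
  · rw [← cancel_mono Z.subschemeι, Category.assoc, Category.assoc, hg, hZπf, Category.id_comp]
  · rw [← Category.assoc, hg, hfπ]
  · rw [Category.assoc, proj_structureMap]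

end Retraction

end Atlas

/-! ### Laurent monomials in the function field -/

/-- The Laurent monomial `z ^ e₀ * y ^ e₁ * x ^ e₂`. -/
def laurentMonomial (e : Fin 3 → ℤ) : FunField := ∏ k, (coordVar k : FunField) ^ e k

theorem laurentMonomial_zero : laurentMonomial 0 = 1 := by simp [laurentMonomial]

theorem laurentMonomial_add (e f : Fin 3 → ℤ) :
    laurentMonomial (e + f) = laurentMonomial e * laurentMonomial f := by
  simp only [laurentMonomial, Pi.add_apply, ← Finset.prod_mul_distrib]
  exact Finset.prod_congr rfl fun k _ => zpow_add₀ (Units.ne_zero _) _ _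

theorem laurentMonomial_neg (e : Fin 3 → ℤ) :
    laurentMonomial (-e) = (laurentMonomial e)⁻¹ := by
  simp only [laurentMonomial, Pi.neg_apply, zpow_neg, Finset.prod_inv_distrib]

theorem laurentMonomial_sub (e f : Fin 3 → ℤ) :
    laurentMonomial (e - f) = laurentMonomial e / laurentMonomial f := by
  rw [sub_eq_add_neg, laurentMonomial_add, laurentMonomial_neg, div_eq_mul_inv]

theorem laurentMonomial_zsmul (m : ℤ) (e : Fin 3 → ℤ) :
    laurentMonomial (m • e) = laurentMonomial e ^ m := by
  simp only [laurentMonomial, Pi.smul_apply, smul_eq_mul, ← Finset.prod_zpow]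
  exact Finset.prod_congr rfl fun _ _ => by rw [mul_comm, zpow_mul]

theorem laurentMonomial_single (k : Fin 3) :
    laurentMonomial (Pi.single k 1) = coordVar k := by
  rw [laurentMonomial, Finset.prod_eq_single k]
  · simp
  · intro j _ hj
    simp [hj]
  · simp

theorem laurentMonomial_ne_zero (e : Fin 3 → ℤ) : laurentMonomial e ≠ 0 :=
  Finset.prod_ne_zero_iff.mpr fun _ _ => zpow_ne_zero _ (Units.ne_zero _)

theorem laurentMonomial_natCast (e : Fin 3 →₀ ℕ) :
    laurentMonomial (fun k => (e k : ℤ)) =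
      algebraMap (MvPolynomial (Fin 3) ℂ) FunField (MvPolynomial.monomial e 1) := by
  rw [MvPolynomial.monomial_eq, Finsupp.prod_fintype _ _ (fun _ => pow_zero _)]
  simp [laurentMonomial, coordVar]

theorem linearIndependent_laurentMonomial : LinearIndependent ℂ laurentMonomial := by
  rw [linearIndependent_iff']
  intro s g hg e he
  -- multiply by a monomial that clears all denominators
  let N : Fin 3 → ℤ := fun k => ∑ e ∈ s, |e k|
  have hN : ∀ e ∈ s, ∀ k, 0 ≤ e k + N k := fun e he k => by
    have := Finset.single_le_sum (f := fun e : Fin 3 → ℤ => |e k|) (fun _ _ => abs_nonneg _) he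
    have h2 := neg_abs_le (e k)
    simp only [N]
    linarith
  let φ : (Fin 3 → ℤ) → (Fin 3 →₀ ℕ) := fun e =>
    Finsupp.equivFunOnFinite.symm fun k => (e k + N k).toNat
  have hφ : ∀ e ∈ s, laurentMonomial e * laurentMonomial N =
      algebraMap (MvPolynomial (Fin 3) ℂ) FunField (MvPolynomial.monomial (φ e) 1) := by
    intro e he
    rw [← laurentMonomial_natCast, ← laurentMonomial_add]
    congr 1
    ext k
    simp [φ, hN e he k]
  have hφi : ∀ e ∈ s, ∀ f ∈ s, φ e = φ f → e = f := by
    intro e he f hf h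
    ext k
    have h1 := DFunLike.congr_fun h k
    simp only [φ, Finsupp.equivFunOnFinite_symm_apply_apply] at h1
    have := hN e he k
    have := hN f hf k
    omega
  have h0 : ∑ e ∈ s, MvPolynomial.monomial (φ e) (g e) = 0 := by
    apply FaithfulSMul.algebraMap_injective (MvPolynomial (Fin 3) ℂ) FunField
    rw [map_zero, map_sum, ← zero_mul (laurentMonomial N), ← hg, Finset.sum_mul]
    refine Finset.sum_congr rfl fun e he => ?_
    rw [smul_mul_assoc, hφ e he, Algebra.smul_def, IsScalarTower.algebraMap_apply ℂ
      (MvPolynomial (Fin 3) ℂ) FunField, ← map_mul, MvPolynomial.algebraMap_eq,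
      MvPolynomial.C_mul_monomial, mul_one]
  have h1 := congrArg (MvPolynomial.coeff (φ e)) h0
  rw [MvPolynomial.coeff_sum, Finset.sum_eq_single e] at h1
  · simpa using h1
  · intro f hf hfe
    rw [MvPolynomial.coeff_monomial, if_neg fun h => hfe (hφi f hf e he h)]
  · exact fun h => absurd he h

/-- The Laurent polynomials with exponents in `S`. -/
def laurentSpan (S : Set (Fin 3 → ℤ)) : Submodule ℂ FunField :=
  Submodule.span ℂ (laurentMonomial '' S)

theorem laurentMonomial_mem_laurentSpan {S : Set (Fin 3 → ℤ)} {e : Fin 3 → ℤ} :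
    laurentMonomial e ∈ laurentSpan S ↔ e ∈ S :=
  ⟨fun h => by_contra fun he => linearIndependent_laurentMonomial.notMem_span_image he h,
    fun h => Submodule.subset_span ⟨e, h, rfl⟩⟩

theorem laurentSpan_mono {S T : Set (Fin 3 → ℤ)} (h : S ⊆ T) : laurentSpan S ≤ laurentSpan T :=
  Submodule.span_mono (Set.image_mono h)

theorem laurentSpan_iInter {ι : Type} [Nonempty ι] (S : ι → Set (Fin 3 → ℤ)) :
    laurentSpan (⋂ i, S i) = ⨅ i, laurentSpan (S i) := by
  simp only [laurentSpan, Finsupp.span_image_eq_map_linearCombination, Finsupp.supported_iInter]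
  exact Submodule.map_iInf _ linearIndependent_laurentMonomial

theorem laurentSpan_inter (S T : Set (Fin 3 → ℤ)) :
    laurentSpan (S ∩ T) = laurentSpan S ⊓ laurentSpan T := by
  simp only [laurentSpan, Finsupp.span_image_eq_map_linearCombination, Finsupp.supported_inter]
  exact Submodule.map_inf _ linearIndependent_laurentMonomial

theorem laurentSpan_empty : laurentSpan ∅ = ⊥ := by simp [laurentSpan]

theorem mul_laurentMonomial_mem_laurentSpan {S : Set (Fin 3 → ℤ)} {d : Fin 3 → ℤ}
    {x : FunField} :
    x * laurentMonomial d ∈ laurentSpan S ↔ x ∈ laurentSpan {e | e + d ∈ S} := by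
  have key : ∀ (T U : Set (Fin 3 → ℤ)) (d : Fin 3 → ℤ), (∀ e ∈ T, e + d ∈ U) →
      ∀ x ∈ laurentSpan T, x * laurentMonomial d ∈ laurentSpan U := by
    intro T U d h x hx
    induction hx using Submodule.span_induction with
    | mem x hx =>
      obtain ⟨e, he, rfl⟩ := hx
      rw [← laurentMonomial_add, laurentMonomial_mem_laurentSpan]
      exact h e he
    | zero => rw [zero_mul]; exact zero_mem _
    | add x y _ _ hx hy => rw [add_mul]; exact add_mem hx hy
    | smul c x _ hx => rw [smul_mul_assoc]; exact Submodule.smul_mem _ c hx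
  constructor
  · intro h
    have := key S {e | e + d ∈ S} (-d) (fun e he => by simpa using he) _ h
    rwa [mul_assoc, ← laurentMonomial_add, add_neg_cancel, laurentMonomial_zero, mul_one] at this
  · exact key _ _ d (fun e he => he) x

theorem div_laurentMonomial_mem_laurentSpan {S : Set (Fin 3 → ℤ)} {d : Fin 3 → ℤ}
    {x : FunField} :
    x / laurentMonomial d ∈ laurentSpan S ↔ x ∈ laurentSpan {e | e - d ∈ S} := by
  rw [div_eq_mul_inv, ← laurentMonomial_neg, mul_laurentMonomial_mem_laurentSpan]
  simp only [sub_eq_add_neg]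

/-- The algebra generated by monomials is spanned by the monomials in the generated monoid. -/
theorem mem_adjoin_laurentMonomial_iff (S : Set (Fin 3 → ℤ)) (x : FunField) :
    x ∈ Algebra.adjoin ℂ (laurentMonomial '' S) ↔
      x ∈ laurentSpan (AddSubmonoid.closure S : Set (Fin 3 → ℤ)) := by
  constructor
  · intro hx
    induction hx using Algebra.adjoin_induction with
    | mem x hx => exact laurentSpan_mono AddSubmonoid.subset_closure (Submodule.subset_span hx)
    | algebraMap c =>
      rw [Algebra.algebraMap_eq_smul_one, ← laurentMonomial_zero]
      exact Submodule.smul_mem _ c (laurentMonomial_mem_laurentSpan.mpr (zero_mem _))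
    | add x y _ _ hx hy => exact add_mem hx hy
    | mul x y hx' hy' hx hy =>
      clear hx' hy'
      induction hy using Submodule.span_induction with
      | mem y hy =>
        obtain ⟨e, he, rfl⟩ := hy
        rw [mul_laurentMonomial_mem_laurentSpan]
        refine laurentSpan_mono ?_ hx
        exact fun f hf => add_mem (S := AddSubmonoid (Fin 3 → ℤ)) hf he
      | zero => rw [mul_zero]; exact zero_mem _
      | add y z _ _ hy hz => rw [mul_add]; exact add_mem hy hz
      | smul c y _ hy => rw [mul_smul_comm]; exact Submodule.smul_mem _ c hy
  · intro hx
    refine (Submodule.span_le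
      (p := Subalgebra.toSubmodule (Algebra.adjoin ℂ (laurentMonomial '' S)))).mpr ?_ hx
    rintro _ ⟨e, he, rfl⟩
    change laurentMonomial e ∈ Algebra.adjoin ℂ (laurentMonomial '' S)
    induction he using AddSubmonoid.closure_induction with
    | mem e he => exact Algebra.subset_adjoin ⟨e, he, rfl⟩
    | zero => rw [laurentMonomial_zero]; exact one_mem _
    | add e f _ _ he hf => rw [laurentMonomial_add]; exact mul_mem he hf

/-! ### Differential forms -/

/-- The basis `dz, dy, dx` of the rational differentials. -/
def kaehlerBasis : Module.Basis (Fin 3) FunField Ω[FunField⁄ℂ] :=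
  ((KaehlerDifferential.mvPolynomialBasis ℂ (Fin 3)).baseChange FunField).map
    (KaehlerDifferential.tensorKaehlerEquivOfFormallyEtale ℂ (MvPolynomial (Fin 3) ℂ) FunField)

theorem kaehlerBasis_apply (k : Fin 3) :
    kaehlerBasis k = KaehlerDifferential.D ℂ FunField (coordVar k) := by
  simp [kaehlerBasis, KaehlerDifferential.mvPolynomialBasis_apply, coordVar]

theorem derivation_mul_mul {K M : Type} [Field K] [Algebra ℂ K] [AddCommGroup M] [Module K M]
    [Module ℂ M] (D : Derivation ℂ K M) {a b c : K} {u v w : M} (ha : D a = a • u)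
    (hb : D b = b • v) (hc : D c = c • w) : D (a * b * c) = (a * b * c) • (u + v + w) := by
  rw [Derivation.leibniz, Derivation.leibniz, ha, hb, hc]
  module

theorem D_laurentMonomial (e : Fin 3 → ℤ) :
    KaehlerDifferential.D ℂ FunField (laurentMonomial e) =
      laurentMonomial e • ∑ k, ((e k : FunField) * (coordVar k : FunField)⁻¹) • kaehlerBasis k := by
  have h : ∀ k : Fin 3, KaehlerDifferential.D ℂ FunField ((coordVar k : FunField) ^ e k) =
      (coordVar k : FunField) ^ e k • ((e k : FunField) * (coordVar k : FunField)⁻¹) •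
        kaehlerBasis k := by
    intro k
    rw [Derivation.leibniz_zpow, kaehlerBasis_apply, smul_smul, ← Int.cast_smul_eq_zsmul FunField,
      smul_smul, zpow_sub_one₀ (Units.ne_zero _)]
    congr 1
    ring
  rw [laurentMonomial, Fin.prod_univ_three, Fin.sum_univ_three]
  exact derivation_mul_mul _ (h 0) (h 1) (h 2)

/-- An alternating map in top degree is determined by its value on a basis. -/
theorem ιMulti_eq_det_smul {K M : Type} [Field K] [AddCommGroup M] [Module K M] {d : ℕ}
    (b : Module.Basis (Fin d) K M) (v : Fin d → M) :
    exteriorPower.ιMulti K d v = b.det v • exteriorPower.ιMulti K d b := by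
  have : exteriorPower.ιMulti K d (M := M) =
      (LinearMap.toSpanSingleton K _ (exteriorPower.ιMulti K d b)).compAlternatingMap b.det := by
    refine Module.Basis.ext_alternating b fun σ hσ => ?_
    have hb : Function.Bijective σ := Finite.injective_iff_bijective.mp hσ
    have e : (fun i => b (σ i)) = b ∘ (Equiv.ofBijective σ hb) := rfl
    rw [e, AlternatingMap.map_perm, AlternatingMap.map_perm]
    simp [Module.Basis.det_self]
  exact DFunLike.congr_fun this v

namespace Atlas

section Forms

variable {K : Type} [Field K] [Algebra ℂ K] {𝒜 : Atlas K} {d : ℕ}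

/-- If `du₁, …, du_d` generate the differentials of a chart, then `du₁ ∧ ⋯ ∧ du_d` generates its
regular forms. -/
theorem regularForms_eq_span (b : Module.Basis (Fin d) K Ω[K⁄ℂ]) (i : 𝒜.ι) (S : Set K)
    (hS : 𝒜.ring i = Algebra.adjoin ℂ S) (u : Fin d → K) (hu : ∀ k, u k ∈ 𝒜.ring i)
    (hD : ∀ s ∈ S, ∃ c : Fin d → 𝒜.ring i, KaehlerDifferential.D ℂ K s =
      ∑ k, (c k : K) • KaehlerDifferential.D ℂ K (u k)) :
    𝒜.regularForms d i = Submodule.span (𝒜.ring i)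
      {b.det (fun k => KaehlerDifferential.D ℂ K (u k)) • exteriorPower.ιMulti K d b} := by
  have hD' : ∀ a ∈ 𝒜.ring i, ∃ c : Fin d → 𝒜.ring i, KaehlerDifferential.D ℂ K a =
      ∑ k, (c k : K) • KaehlerDifferential.D ℂ K (u k) := by
    intro a ha
    have hS' : ∀ x ∈ Algebra.adjoin ℂ S, x ∈ 𝒜.ring i := fun x hx => hS ▸ hx
    rw [hS] at ha
    induction ha using Algebra.adjoin_induction with
    | mem x hx => exact hD x hx
    | algebraMap r => exact ⟨0, by simp⟩
    | add x y _ _ hx hy =>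
      obtain ⟨c, hc⟩ := hx
      obtain ⟨e, he⟩ := hy
      exact ⟨c + e, by simp [hc, he, add_smul, Finset.sum_add_distrib]⟩
    | mul x y hx' hy' hx hy =>
      obtain ⟨c, hc⟩ := hx
      obtain ⟨e, he⟩ := hy
      refine ⟨(⟨x, hS' x hx'⟩ : 𝒜.ring i) • e + (⟨y, hS' y hy'⟩ : 𝒜.ring i) • c, ?_⟩
      simp [hc, he, add_smul, Finset.sum_add_distrib, Finset.smul_sum, smul_smul]
  rw [regularForms]
  apply le_antisymm
  · refine Submodule.span_le.mpr ?_
    rintro _ ⟨a, rfl⟩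
    choose c hc using fun k => hD' (a k) (a k).2
    refine Submodule.mem_span_singleton.mpr ⟨(Matrix.of c).det, ?_⟩
    dsimp only
    rw [ιMulti_eq_det_smul b (fun k => KaehlerDifferential.D ℂ K (a k : K)),
      Subalgebra.smul_def, smul_smul, Module.Basis.det_apply, Module.Basis.det_apply]
    congr 1
    have h1 : (((Matrix.of c).det : 𝒜.ring i) : K) =
        (Matrix.of fun k l => (c k l : K)).transpose.det := by
      rw [Matrix.det_transpose]
      exact RingHom.map_det (𝒜.ring i).val.toRingHom (Matrix.of c)
    rw [h1, mul_comm, ← Matrix.det_mul]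
    congr 1
    ext j k
    rw [Module.Basis.toMatrix_apply, hc k, Matrix.mul_apply, map_sum, Finset.sum_apply']
    refine Finset.sum_congr rfl fun l _ => ?_
    rw [map_smul, Finsupp.smul_apply, smul_eq_mul, mul_comm]
    rfl
  · rw [Submodule.span_singleton_le_iff_mem]
    refine Submodule.subset_span ⟨fun k => ⟨u k, hu k⟩, ?_⟩
    exact ιMulti_eq_det_smul b _

/-- If the rational form `ω` has divisor `-D`, i.e. the regular forms on each chart are the regular
multiples of `(gen D i)⁻¹ • ω`, then evaluation at `ω` identifies `|-m K_X|` with `|m D|`. -/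
theorem antiCanonicalSystem_eq_linearSystem (m : ℕ) (D : 𝒜.lineBundles) (ω : ⋀[K]^d Ω[K⁄ℂ])
    (hspan : ∀ η : ⋀[K]^d Ω[K⁄ℂ], ∃ r : K, η = r • ω) (φ : ⋀[K]^d Ω[K⁄ℂ] →ₗ[K] K)
    (hφ : φ ω = 1)
    (hD : ∀ i, 𝒜.regularForms d i = Submodule.span (𝒜.ring i) {(gen D i)⁻¹ • ω}) :
    𝒜.antiCanonicalSystem d m = linearSystem (m • D) := by
  have hgen : ∀ i, gen (m • D) i = gen D i ^ m := fun i => by simp [gen]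
  have hreg : ∀ i η, η ∈ 𝒜.regularForms d i ↔
      ∃ r : 𝒜.ring i, η = ((r : K) * (gen D i)⁻¹) • ω := by
    intro i η
    rw [hD i, Submodule.mem_span_singleton]
    refine exists_congr fun r => ?_
    rw [Subalgebra.smul_def, smul_smul, eq_comm]
  -- the value on regular forms in terms of the value at `ω`
  have hθ : ∀ (θ : MultilinearMap K (fun _ : Fin m => ⋀[K]^d Ω[K⁄ℂ]) K) (i : 𝒜.ι)
      (r : Fin m → 𝒜.ring i), θ (fun k => ((r k : K) * (gen D i)⁻¹) • ω) =
        ((∏ k, r k : 𝒜.ring i) : K) * (θ (fun _ => ω) / gen (m • D) i) := by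
    intro θ i r
    rw [θ.map_smul_univ (fun k => (r k : K) * (gen D i)⁻¹) (fun _ => ω), Finset.prod_mul_distrib,
      hgen, smul_eq_mul]
    have hr : ((∏ k, r k : 𝒜.ring i) : K) = ∏ k, (r k : K) := map_prod (𝒜.ring i).val _ _
    simp only [Finset.prod_const, Finset.card_univ, Fintype.card_fin, inv_pow, hr]
    ring
  have hval : ∀ (θ : MultilinearMap K (fun _ : Fin m => ⋀[K]^d Ω[K⁄ℂ]) K) (i : 𝒜.ι)
      (η : Fin m → ⋀[K]^d Ω[K⁄ℂ]), (∀ k, η k ∈ 𝒜.regularForms d i) →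
        ∃ r : 𝒜.ring i, θ η = (r : K) * (θ (fun _ => ω) / gen (m • D) i) := by
    intro θ i η hη
    choose r hr using fun k => (hreg i (η k)).mp (hη k)
    exact ⟨∏ k, r k, by rw [← hθ]; exact congrArg θ (funext hr)⟩
  have hone : ∀ (θ : MultilinearMap K (fun _ : Fin m => ⋀[K]^d Ω[K⁄ℂ]) K) (i : 𝒜.ι),
      ∃ η : Fin m → ⋀[K]^d Ω[K⁄ℂ], (∀ k, η k ∈ 𝒜.regularForms d i) ∧
        θ η = θ (fun _ => ω) / gen (m • D) i := by
    intro θ i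
    refine ⟨fun _ => (((1 : 𝒜.ring i) : K) * (gen D i)⁻¹) • ω, fun k => (hreg _ _).mpr ⟨1, rfl⟩,
      ?_⟩
    rw [hθ θ i fun _ => 1]
    simp
  have hsec : ∀ θ : MultilinearMap K (fun _ : Fin m => ⋀[K]^d Ω[K⁄ℂ]) K,
      𝒜.IsPluriAnticanonicalSection θ ↔ IsSection (m • D) (θ fun _ => ω) := by
    intro θ
    constructor
    · intro h i
      obtain ⟨η, hη, e⟩ := hone θ i
      rw [← e]
      exact h i η hη
    · intro h i η hη
      obtain ⟨r, e⟩ := hval θ i η hη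
      rw [e]
      exact mul_mem r.2 (h i)
  have hzero : ∀ θ : MultilinearMap K (fun _ : Fin m => ⋀[K]^d Ω[K⁄ℂ]) K,
      (θ fun _ => ω) = 0 → θ = 0 := by
    intro θ h
    ext η
    choose r hr using fun k => hspan (η k)
    rw [show η = fun k => r k • ω from funext hr, θ.map_smul_univ, h, smul_zero]
    rfl
  have hideal : ∀ θ : MultilinearMap K (fun _ : Fin m => ⋀[K]^d Ω[K⁄ℂ]) K,
      IsSection (m • D) (θ fun _ => ω) → ∀ i,
      Ideal.span {a : 𝒜.ring i | ∃ η : Fin m → ⋀[K]^d Ω[K⁄ℂ],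
        (∀ k, η k ∈ 𝒜.regularForms d i) ∧ (a : K) = θ η} =
      Ideal.span {a : 𝒜.ring i | (a : K) = (θ fun _ => ω) / gen (m • D) i} := by
    intro θ h i
    rw [h.span_eq]
    apply le_antisymm
    · refine Ideal.span_le.mpr ?_
      rintro a ⟨η, hη, ha⟩
      obtain ⟨r, e⟩ := hval θ i η hη
      refine Ideal.mem_span_singleton'.mpr ⟨r, Subtype.ext ?_⟩
      rw [ha, e]
      rfl
    · rw [Ideal.span_singleton_le_iff_mem]
      obtain ⟨η, hη, e⟩ := hone θ i
      exact Ideal.subset_span ⟨η, hη, e.symm⟩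
  ext Z
  constructor
  · rintro ⟨θ, h0, hs, hZ⟩
    have hs' := (hsec θ).mp hs
    exact ⟨θ fun _ => ω, fun h => h0 (hzero θ h), hs', fun i =>
      (hZ i).trans (congrArg _ (hideal θ hs' i))⟩
  · rintro ⟨s, h0, hs, hZ⟩
    let θ : MultilinearMap K (fun _ : Fin m => ⋀[K]^d Ω[K⁄ℂ]) K :=
      s • (MultilinearMap.mkPiAlgebra K (Fin m) K).compLinearMap fun _ => φ
    have hθω : (θ fun _ => ω) = s := by simp [θ, hφ]
    rw [← hθω] at hs h0
    refine ⟨θ, fun h => h0 (by rw [h]; rfl), (hsec θ).mpr hs, fun i => (hZ i).trans ?_⟩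
    beta_reduce
    rw [hideal θ hs i, hθω]

end Forms

end Atlas

/-- The rational `3`-form `dz ∧ dy ∧ dx`. -/
def coordForm : ⋀[FunField]^3 Ω[FunField⁄ℂ] := exteriorPower.ιMulti FunField 3 kaehlerBasis

/-- The rational `3`-forms are a one-dimensional vector space. -/
theorem exists_eq_smul_coordForm (η : ⋀[FunField]^3 Ω[FunField⁄ℂ]) :
    ∃ r : FunField, η = r • coordForm := by
  have h : η ∈ Submodule.span FunField {coordForm} := by
    have : Submodule.span FunField (Set.range (exteriorPower.ιMulti FunField 3
        (M := Ω[FunField⁄ℂ]))) ≤ Submodule.span FunField {coordForm} := by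
      refine Submodule.span_le.mpr ?_
      rintro _ ⟨v, rfl⟩
      exact Submodule.mem_span_singleton.mpr ⟨_, (ιMulti_eq_det_smul kaehlerBasis v).symm⟩
    rw [exteriorPower.ιMulti_span] at this
    exact this trivial
  obtain ⟨r, hr⟩ := Submodule.mem_span_singleton.mp h
  exact ⟨r, hr.symm⟩

/-- The form `dz ∧ dy ∧ dx` is not zero. -/
theorem exists_dual_coordForm :
    ∃ φ : ⋀[FunField]^3 Ω[FunField⁄ℂ] →ₗ[FunField] FunField, φ coordForm = 1 :=
  ⟨exteriorPower.alternatingMapLinearEquiv kaehlerBasis.det, by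
    rw [coordForm, exteriorPower.alternatingMapLinearEquiv_apply_ιMulti, Module.Basis.det_self]⟩

/-- The determinant of `d u₁, d u₂, d u₃` for Laurent monomials `uₖ` with exponents `M k`. -/
theorem det_D_laurentMonomial (M : Fin 3 → Fin 3 → ℤ) :
    kaehlerBasis.det (fun k => KaehlerDifferential.D ℂ FunField (laurentMonomial (M k))) =
      ((Matrix.of M).det : FunField) * laurentMonomial (M 0 + M 1 + M 2 - 1) := by
  have h : kaehlerBasis.toMatrix
      (fun k => KaehlerDifferential.D ℂ FunField (laurentMonomial (M k))) =
      (Matrix.diagonal (fun k => laurentMonomial (M k)) * (Matrix.of M).map (Int.castRingHom _) *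
        Matrix.diagonal fun k => (coordVar k : FunField)⁻¹).transpose := by
    ext j k
    rw [Matrix.transpose_apply, Matrix.mul_diagonal, Matrix.diagonal_mul,
      Module.Basis.toMatrix_apply, D_laurentMonomial, map_smul, Finsupp.smul_apply,
      Module.Basis.repr_sum_self]
    simp [mul_assoc]
  have h1 : laurentMonomial 1 = ∏ k, (coordVar k : FunField) := by simp [laurentMonomial]
  rw [Module.Basis.det_apply, h, Matrix.det_transpose, Matrix.det_mul, Matrix.det_mul,
    Matrix.det_diagonal, Matrix.det_diagonal, ← RingHom.mapMatrix_apply, ← RingHom.map_det,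
    laurentMonomial_sub, laurentMonomial_add, laurentMonomial_add, h1, Fin.prod_univ_three,
    Finset.prod_inv_distrib]
  simp only [eq_intCast]
  ring

/-! ### Charts of projective line bundles -/

namespace Atlas

namespace FiberChart

instance : Finite FiberChart :=
  Finite.of_surjective (fun k : Fin 3 => ![fst, snd, both] k) fun c => by
    cases c
    exacts [⟨0, rfl⟩, ⟨1, rfl⟩, ⟨2, rfl⟩]

/-- The exponent of `u` in the local generator of `𝒪(1)`: one on the chart
`snd` at infinity, zero elsewhere. -/
def twist : FiberChart → ℤ
  | fst => 0
  | snd => 1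
  | both => 0

/-- The exponents `k` for which `u ^ k` is regular on the chart. -/
def Allows : FiberChart → ℤ → Prop
  | fst, k => 0 ≤ k
  | snd, k => k ≤ 0
  | both, _ => True

/-- The exponents of the functions adjoined on a chart of a `ℙ¹` whose coordinate is the monomial
with exponent `w`. -/
def coordExps (w : Fin 3 → ℤ) : FiberChart → Set (Fin 3 → ℤ)
  | fst => {w}
  | snd => {-w}
  | both => {w, -w}

theorem image_coordExps (w : Fin 3 → ℤ) (c : FiberChart) :
    laurentMonomial '' coordExps w c = coords (laurentMonomial w) c := by
  cases c <;> simp [coordExps, coords, Set.image_insert_eq, laurentMonomial_neg]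

theorem mem_closure_coordExps (w e : Fin 3 → ℤ) (c : FiberChart) :
    e ∈ AddSubmonoid.closure (coordExps w c) ↔ ∃ k : ℤ, c.Allows k ∧ e = k • w := by
  constructor
  · intro h
    induction h using AddSubmonoid.closure_induction with
    | mem e he =>
      cases c
      · obtain rfl : e = w := he
        exact ⟨1, by simp [Allows], by simp⟩
      · obtain rfl : e = -w := he
        exact ⟨-1, by simp [Allows], by simp⟩
      · rcases he with rfl | he
        · exact ⟨1, trivial, by simp⟩
        · obtain rfl : e = -w := he
          exact ⟨-1, trivial, by simp⟩
    | zero => exact ⟨0, by cases c <;> simp [Allows], by simp⟩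
    | add e f _ _ he hf =>
      obtain ⟨k, hk, rfl⟩ := he
      obtain ⟨l, hl, rfl⟩ := hf
      refine ⟨k + l, ?_, (add_smul k l w).symm⟩
      cases c <;> simp only [Allows] at * <;> omega
  · rintro ⟨k, hk, rfl⟩
    have pos : ∀ v ∈ coordExps w c, ∀ m : ℕ,
        (m : ℤ) • v ∈ AddSubmonoid.closure (coordExps w c) := by
      intro v hv m
      rw [natCast_zsmul]
      exact nsmul_mem (AddSubmonoid.subset_closure hv) m
    cases c
    · obtain ⟨m, rfl⟩ := Int.eq_ofNat_of_zero_le hk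
      exact pos w rfl m
    · obtain ⟨m, hm⟩ := Int.eq_ofNat_of_zero_le (neg_nonneg.mpr hk)
      obtain rfl : k = -m := by omega
      rw [neg_smul, ← smul_neg]
      exact pos (-w) rfl m
    · obtain ⟨m, rfl | rfl⟩ := Int.eq_nat_or_neg k
      · exact pos w (Or.inl rfl) m
      · rw [neg_smul, ← smul_neg]
        exact pos (-w) (Or.inr rfl) m

end FiberChart

section Gen

variable {K : Type} [Field K] [Algebra ℂ K] {𝒜 : Atlas K}

theorem gen_add (D E : 𝒜.lineBundles) (i : 𝒜.ι) : gen (D + E) i = gen D i * gen E i := by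
  simp [gen]

theorem gen_neg (D : 𝒜.lineBundles) (i : 𝒜.ι) : gen (-D) i = (gen D i)⁻¹ := by
  simp [gen]

theorem gen_sub (D E : 𝒜.lineBundles) (i : 𝒜.ι) : gen (D - E) i = gen D i / gen E i := by
  rw [sub_eq_add_neg, gen_add, gen_neg, div_eq_mul_inv]

theorem gen_nsmul (m : ℕ) (D : 𝒜.lineBundles) (i : 𝒜.ι) : gen (m • D) i = gen D i ^ m := by
  simp [gen]

theorem gen_zero (i : 𝒜.ι) : gen (0 : 𝒜.lineBundles) i = 1 := by
  simp [gen]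

theorem gen_pullback (L : 𝒜.lineBundles) (t : Kˣ) (D : 𝒜.lineBundles) (i : 𝒜.ι)
    (c : FiberChart) : gen (𝒜.pullback L t D) (i, c) = gen D i := rfl

end Gen

/-! ### Monomial charts -/

section Monomial

variable {𝒜 : Atlas FunField} (L : 𝒜.lineBundles) (t : FunFieldˣ) (i : 𝒜.ι)

theorem gen_tautological_eq_laurentMonomial {w : Fin 3 → ℤ}
    (hw : gen L i * t = laurentMonomial w) (c : FiberChart) :
    gen (𝒜.tautological L t) (i, c) = laurentMonomial (c.twist • w) := by
  cases c
  · simp [tautological, tautologicalGen, gen, FiberChart.twist, laurentMonomial_zero]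
  · simp only [FiberChart.twist, one_smul, ← hw]
    simp [tautological, tautologicalGen, gen]
  · simp [tautological, tautologicalGen, gen, FiberChart.twist, laurentMonomial_zero]

theorem bundleRing_eq_adjoin {S : Set (Fin 3 → ℤ)} {w : Fin 3 → ℤ}
    (hS : 𝒜.ring i = Algebra.adjoin ℂ (laurentMonomial '' S))
    (hw : gen L i * t = laurentMonomial w) (c : FiberChart) :
    𝒜.bundleRing L t i c =
      Algebra.adjoin ℂ (laurentMonomial '' (S ∪ FiberChart.coordExps w c)) := by
  rw [bundleRing, hS, hw, ← FiberChart.image_coordExps, Set.image_union, Algebra.adjoin_union]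

end Monomial

end Atlas

open Atlas

/-! ### The charts of the threefold -/

/-- The exponent of the coordinate `z` of `ℙ¹`. -/
def fiberExp₁ : Fin 3 → ℤ := ![1, 0, 0]

/-- The exponent of the fibre coordinate of `𝔽ₙ → ℙ¹` over the chart `a`. -/
def fiberExp₂ (n : ℕ) (a : FiberChart) : Fin 3 → ℤ := ![-(n * a.twist), 1, 0]

/-- The exponent of the fibre coordinate of `X → 𝔽ₙ` over the chart `(a, b)`. -/
def fiberExp₃ (n : ℕ) (a b : FiberChart) : Fin 3 → ℤ :=
  ![a.twist + 2 * n * a.twist * b.twist, -2 * b.twist, 1]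

/-- The exponents of the monomials which are regular on the chart `(a, b, c)` of `X`:
the conditions are on the coordinates with respect to the basis `fiberExp₁`, `fiberExp₂`,
`fiberExp₃` of `ℤ³`. -/
def chartCone (n : ℕ) (a b c : FiberChart) : Set (Fin 3 → ℤ) :=
  {e | a.Allows (e 0 + a.twist * (n * e 1 - e 2)) ∧ b.Allows (e 1 + 2 * b.twist * e 2) ∧
    c.Allows (e 2)}

theorem eq_combination_fiberExp (n : ℕ) (a b : FiberChart) (e : Fin 3 → ℤ) (k₁ k₂ k₃ : ℤ) :
    e = k₁ • fiberExp₁ + k₂ • fiberExp₂ n a + k₃ • fiberExp₃ n a b ↔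
      k₁ = e 0 + a.twist * (n * e 1 - e 2) ∧ k₂ = e 1 + 2 * b.twist * e 2 ∧ k₃ = e 2 := by
  constructor
  · rintro rfl
    simp [fiberExp₁, fiberExp₂, fiberExp₃]
    constructor <;> ring
  · rintro ⟨rfl, rfl, rfl⟩
    ext k
    fin_cases k <;> simp [fiberExp₁, fiberExp₂, fiberExp₃] <;> ring

theorem laurentMonomial_coordVar_zero : (coordVar 0 : FunField) = laurentMonomial fiberExp₁ := by
  rw [← laurentMonomial_single]
  congr 1
  ext k
  fin_cases k <;> rfl

theorem gen_projLineO1 (u : Unit) (a : FiberChart) :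
    gen projLineO1 (u, a) = laurentMonomial (a.twist • fiberExp₁) :=
  gen_tautological_eq_laurentMonomial _ _ _
    (by rw [gen_zero, one_mul, laurentMonomial_coordVar_zero]) a

theorem gen_hirzebruch_coord (n : ℕ) (u : Unit) (a : FiberChart) :
    gen (-(n • projLineO1)) (u, a) * (coordVar 1 : FunField) =
      laurentMonomial (fiberExp₂ n a) := by
  rw [gen_neg, gen_nsmul, gen_projLineO1, ← zpow_natCast, ← laurentMonomial_zsmul,
    ← laurentMonomial_neg, ← laurentMonomial_single, ← laurentMonomial_add]
  congr 1
  ext k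
  fin_cases k <;> simp [fiberExp₁, fiberExp₂]

theorem gen_hirzebruchC₀ (n : ℕ) (u : Unit) (a b : FiberChart) :
    gen (hirzebruchC₀ n) ((u, a), b) = laurentMonomial (b.twist • fiberExp₂ n a) :=
  gen_tautological_eq_laurentMonomial _ _ _ (gen_hirzebruch_coord n u a) b

theorem gen_hirzebruchF (n : ℕ) (u : Unit) (a b : FiberChart) :
    gen (hirzebruchF n) ((u, a), b) = laurentMonomial (a.twist • fiberExp₁) :=
  gen_projLineO1 u a

theorem gen_hirzebruchA (n : ℕ) (u : Unit) (a b : FiberChart) :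
    gen (hirzebruchA n) ((u, a), b) =
      laurentMonomial ((2 * b.twist) • fiberExp₂ n a - a.twist • fiberExp₁) := by
  rw [hirzebruchA, gen_sub, gen_nsmul, gen_hirzebruchC₀, gen_hirzebruchF, ← zpow_natCast,
    ← laurentMonomial_zsmul, ← laurentMonomial_sub, smul_smul]
  rfl

theorem gen_scroll_coord (n : ℕ) (u : Unit) (a b : FiberChart) :
    gen (-hirzebruchA n) ((u, a), b) * (coordVar 2 : FunField) =
      laurentMonomial (fiberExp₃ n a b) := by
  rw [gen_neg, gen_hirzebruchA, ← laurentMonomial_neg, ← laurentMonomial_single,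
    ← laurentMonomial_add]
  congr 1
  ext k
  fin_cases k <;> simp [fiberExp₁, fiberExp₂, fiberExp₃]
  ring

theorem gen_scrollτ (n : ℕ) (u : Unit) (a b c : FiberChart) :
    gen (scrollτ n) (((u, a), b), c) = laurentMonomial (c.twist • fiberExp₃ n a b) :=
  gen_tautological_eq_laurentMonomial _ _ _ (gen_scroll_coord n u a b) c

theorem projLine_ring (u : Unit) (a : FiberChart) :
    projLine.ring (u, a) =
      Algebra.adjoin ℂ (laurentMonomial '' (∅ ∪ FiberChart.coordExps fiberExp₁ a)) :=
  bundleRing_eq_adjoin (𝒜 := pointAtlas) 0 (coordVar 0) u (by simp)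
    (by rw [gen_zero, one_mul, laurentMonomial_coordVar_zero]) a

theorem hirzebruch_ring (n : ℕ) (u : Unit) (a b : FiberChart) :
    (hirzebruch n).ring ((u, a), b) =
      Algebra.adjoin ℂ (laurentMonomial '' (∅ ∪ FiberChart.coordExps fiberExp₁ a ∪
        FiberChart.coordExps (fiberExp₂ n a) b)) :=
  bundleRing_eq_adjoin (𝒜 := projLine) (-(n • projLineO1)) (coordVar 1) (u, a)
    (projLine_ring u a) (gen_hirzebruch_coord n u a) b

theorem scroll_ring (n : ℕ) (u : Unit) (a b c : FiberChart) :
    (scroll n).ring (((u, a), b), c) =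
      Algebra.adjoin ℂ (laurentMonomial '' (∅ ∪ FiberChart.coordExps fiberExp₁ a ∪
        FiberChart.coordExps (fiberExp₂ n a) b ∪ FiberChart.coordExps (fiberExp₃ n a b) c)) :=
  bundleRing_eq_adjoin (𝒜 := hirzebruch n) (-hirzebruchA n) (coordVar 2) ((u, a), b)
    (hirzebruch_ring n u a b) (gen_scroll_coord n u a b) c

theorem mem_projLine_ring_iff (u : Unit) (a : FiberChart) (x : FunField) :
    x ∈ projLine.ring (u, a) ↔ x ∈ laurentSpan {e | a.Allows (e 0) ∧ e 1 = 0 ∧ e 2 = 0} := by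
  rw [projLine_ring, mem_adjoin_laurentMonomial_iff, Set.empty_union]
  suffices h : (AddSubmonoid.closure (FiberChart.coordExps fiberExp₁ a) : Set (Fin 3 → ℤ)) =
      {e | a.Allows (e 0) ∧ e 1 = 0 ∧ e 2 = 0} by rw [h]
  ext e
  rw [SetLike.mem_coe, FiberChart.mem_closure_coordExps]
  constructor
  · rintro ⟨k, hk, rfl⟩
    simpa [fiberExp₁] using hk
  · rintro ⟨h0, h1, h2⟩
    refine ⟨e 0, h0, ?_⟩
    ext k
    fin_cases k <;> simp [fiberExp₁, h1, h2]

theorem mem_scroll_ring_iff (n : ℕ) (u : Unit) (a b c : FiberChart) (x : FunField) :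
    x ∈ (scroll n).ring (((u, a), b), c) ↔ x ∈ laurentSpan (chartCone n a b c) := by
  rw [scroll_ring, mem_adjoin_laurentMonomial_iff, Set.empty_union]
  suffices h : (AddSubmonoid.closure (FiberChart.coordExps fiberExp₁ a ∪
      FiberChart.coordExps (fiberExp₂ n a) b ∪ FiberChart.coordExps (fiberExp₃ n a b) c) :
        Set (Fin 3 → ℤ)) = chartCone n a b c by rw [h]
  ext e
  simp only [SetLike.mem_coe, AddSubmonoid.closure_union, AddSubmonoid.mem_sup,
    FiberChart.mem_closure_coordExps]
  constructor
  · rintro ⟨_, ⟨_, ⟨k₁, h₁, rfl⟩, _, ⟨k₂, h₂, rfl⟩, rfl⟩, _, ⟨k₃, h₃, rfl⟩, he⟩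
    obtain ⟨rfl, rfl, rfl⟩ := (eq_combination_fiberExp n a b e k₁ k₂ k₃).mp he.symm
    exact ⟨h₁, h₂, h₃⟩
  · rintro ⟨h₁, h₂, h₃⟩
    exact ⟨_, ⟨_, ⟨_, h₁, rfl⟩, _, ⟨_, h₂, rfl⟩, rfl⟩, _, ⟨_, h₃, rfl⟩,
      ((eq_combination_fiberExp n a b e _ _ _).mpr ⟨rfl, rfl, rfl⟩).symm⟩

/-- Membership of monomials in the coordinate rings of the charts. -/
theorem laurentMonomial_mem_scroll_ring_iff (n : ℕ) (u : Unit) (a b c : FiberChart)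
    (e : Fin 3 → ℤ) :
    laurentMonomial e ∈ (scroll n).ring (((u, a), b), c) ↔ e ∈ chartCone n a b c := by
  rw [mem_scroll_ring_iff, laurentMonomial_mem_laurentSpan]

/-- The anticanonical line bundle `-K_X = 2τ + 4C₀ + (n+1)F`. -/
def antiCanonical (n : ℕ) : (scroll n).lineBundles :=
  2 • scrollτ n + scrollPullback n (4 • hirzebruchC₀ n + (n + 1) • hirzebruchF n)

theorem gen_antiCanonical (n : ℕ) (u : Unit) (a b c : FiberChart) :
    gen (antiCanonical n) (((u, a), b), c) =
      laurentMonomial ((2 * c.twist) • fiberExp₃ n a b + ((4 * b.twist) • fiberExp₂ n a +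
        ((n + 1) * a.twist) • fiberExp₁)) := by
  rw [antiCanonical, gen_add, gen_nsmul, scrollPullback, gen_pullback, gen_add, gen_nsmul,
    gen_nsmul, gen_scrollτ, gen_hirzebruchC₀, gen_hirzebruchF]
  simp only [← zpow_natCast, ← laurentMonomial_zsmul, ← laurentMonomial_add, smul_smul]
  push_cast
  rfl

namespace Atlas

theorem span_neg_smul_singleton {K M : Type} [Field K] [Algebra ℂ K] [AddCommGroup M] [Module K M]
    (R : Subalgebra ℂ K) (x : K) (m : M) :
    Submodule.span R {(-x) • m} = Submodule.span R {x • m} := by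
  rw [neg_smul, ← Set.neg_singleton, Submodule.span_neg]

/-- The regular top forms on a chart with monomial coordinates (or their inverses), whose exponents
form a basis of `ℤ³`. -/
theorem regularForms_eq_span_laurentMonomial {𝒜 : Atlas FunField} (i : 𝒜.ι)
    {S : Set (Fin 3 → ℤ)} (hring : 𝒜.ring i = Algebra.adjoin ℂ (laurentMonomial '' S))
    (M : Fin 3 → Fin 3 → ℤ) (hMS : ∀ k, M k ∈ S) (hSM : ∀ e ∈ S, ∃ k, e = M k ∨ e = -M k)
    (hdet : (Matrix.of M).det = 1 ∨ (Matrix.of M).det = -1) :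
    𝒜.regularForms 3 i =
      Submodule.span (𝒜.ring i) {laurentMonomial (M 0 + M 1 + M 2 - 1) • coordForm} := by
  have hSr : ∀ e ∈ S, laurentMonomial e ∈ 𝒜.ring i := by
    intro e he
    rw [hring]
    exact Algebra.subset_adjoin ⟨e, he, rfl⟩
  rw [regularForms_eq_span kaehlerBasis _ _ hring (fun k => laurentMonomial (M k))
    (fun k => hSr _ (hMS k)) ?_]
  · rw [det_D_laurentMonomial, ← coordForm]
    rcases hdet with h | h <;> rw [h]
    · rw [Int.cast_one, one_mul]
    · rw [Int.cast_neg, Int.cast_one, neg_one_mul]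
      exact span_neg_smul_singleton _ _ _
  · rintro _ ⟨e, he, rfl⟩
    obtain ⟨k, rfl | rfl⟩ := hSM e he
    · refine ⟨Pi.single k 1, ?_⟩
      rw [Finset.sum_eq_single k]
      · rw [Pi.single_eq_same, OneMemClass.coe_one, one_smul]
      · intro j _ hj
        rw [Pi.single_eq_of_ne hj, ZeroMemClass.coe_zero, zero_smul]
      · exact fun h => absurd (Finset.mem_univ k) h
    · refine ⟨Pi.single k (-(⟨_, hSr _ he⟩ ^ 2)), ?_⟩
      rw [Finset.sum_eq_single k]
      · rw [Pi.single_eq_same]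
        nth_rw 1 [laurentMonomial_neg]
        rw [Derivation.leibniz_inv, ← laurentMonomial_neg]
        rfl
      · intro j _ hj
        rw [Pi.single_eq_of_ne hj, ZeroMemClass.coe_zero, zero_smul]
      · exact fun h => absurd (Finset.mem_univ k) h

end Atlas

/-- The rational form `dz ∧ dy ∧ dx` has divisor `-(2τ + 4C₀ + (n+1)F)`. -/
theorem regularForms_scroll (n : ℕ) (p : (scroll n).ι) :
    (scroll n).regularForms 3 p =
      Submodule.span ((scroll n).ring p) {(gen (antiCanonical n) p)⁻¹ • coordForm} := by
  obtain ⟨⟨⟨u, a⟩, b⟩, c⟩ := p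
  -- the sign of the exponent of the coordinate
  let ε : FiberChart → ℤ := fun c => 1 - 2 * c.twist
  have hε : ∀ c, ε c = 1 ∨ ε c = -1 := by
    intro c
    cases c <;> simp [ε, FiberChart.twist]
  have hεc : ∀ c w, ε c • w ∈ FiberChart.coordExps w c := by
    intro c w
    cases c <;> simp [ε, FiberChart.twist, FiberChart.coordExps]
  have hmem : ∀ c w e, e ∈ FiberChart.coordExps w c → e = ε c • w ∨ e = -(ε c • w) := by
    intro c w e
    cases c <;> simp [ε, FiberChart.twist, FiberChart.coordExps] <;> exact Or.inl
  let M : Fin 3 → Fin 3 → ℤ :=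
    ![ε a • fiberExp₁, ε b • fiberExp₂ n a, ε c • fiberExp₃ n a b]
  have hdet : (Matrix.of M).det = ε a * ε b * ε c := by
    rw [Matrix.det_fin_three]
    simp [M, fiberExp₁, fiberExp₂, fiberExp₃]
  have hsum : M 0 + M 1 + M 2 - 1 = -((2 * c.twist) • fiberExp₃ n a b +
      ((4 * b.twist) • fiberExp₂ n a + ((n + 1) * a.twist) • fiberExp₁)) := by
    ext k
    fin_cases k <;> simp [M, ε, fiberExp₁, fiberExp₂, fiberExp₃] <;> ring
  rw [gen_antiCanonical, ← laurentMonomial_neg, ← hsum]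
  refine regularForms_eq_span_laurentMonomial _ (scroll_ring n u a b c) M ?_ ?_ ?_
  · intro k
    fin_cases k
    · exact Or.inl (Or.inl (Or.inr (hεc _ _)))
    · exact Or.inl (Or.inr (hεc _ _))
    · exact Or.inr (hεc _ _)
  · rintro e (((h | h) | h) | h)
    · exact h.elim
    · exact ⟨0, hmem _ _ _ h⟩
    · exact ⟨1, hmem _ _ _ h⟩
    · exact ⟨2, hmem _ _ _ h⟩
  · rw [hdet]
    rcases hε a with h | h <;> rcases hε b with h' | h' <;> rcases hε c with h'' | h'' <;>
      simp [h, h', h'']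

/-- The system `|-m K_X|` in terms of divisor classes. -/
theorem antiCanonicalSystem_scroll (n m : ℕ) :
    (scroll n).antiCanonicalSystem 3 m = linearSystem (m • antiCanonical n) := by
  obtain ⟨φ, hφ⟩ := exists_dual_coordForm
  exact antiCanonicalSystem_eq_linearSystem m (antiCanonical n) coordForm
    exists_eq_smul_coordForm φ hφ (regularForms_scroll n)

/-! ### Global sections -/

/-- The exponent of the local generator of `γ τ + β C₀ + α F` on the chart `(a, b, c)`. -/
def divisorExp (n : ℕ) (γ β α : ℤ) (a b c : FiberChart) : Fin 3 → ℤ :=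
  (γ * c.twist) • fiberExp₃ n a b + ((β * b.twist) • fiberExp₂ n a + (α * a.twist) • fiberExp₁)

theorem combination_mem_chartCone (n : ℕ) (a b c : FiberChart) (k₁ k₂ k₃ : ℤ) :
    k₁ • fiberExp₁ + k₂ • fiberExp₂ n a + k₃ • fiberExp₃ n a b ∈ chartCone n a b c ↔
      a.Allows k₁ ∧ b.Allows k₂ ∧ c.Allows k₃ := by
  obtain ⟨h₁, h₂, h₃⟩ := (eq_combination_fiberExp n a b _ k₁ k₂ k₃).mp rfl
  rw [chartCone, Set.mem_ofPred_eq, ← h₁, ← h₂, ← h₃]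

theorem eq_combination_fiberExp_self (n : ℕ) (a b : FiberChart) (e : Fin 3 → ℤ) :
    e = (e 0 + a.twist * (n * e 1 - e 2)) • fiberExp₁ +
      (e 1 + 2 * b.twist * e 2) • fiberExp₂ n a + e 2 • fiberExp₃ n a b :=
  (eq_combination_fiberExp n a b e _ _ _).mpr ⟨rfl, rfl, rfl⟩

theorem sub_divisorExp_eq (n : ℕ) (γ β α : ℤ) (a b c : FiberChart) (e : Fin 3 → ℤ) :
    e - divisorExp n γ β α a b c =
      (e 0 + a.twist * (n * e 1 - e 2) - α * a.twist) • fiberExp₁ +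
      (e 1 + 2 * b.twist * e 2 - β * b.twist) • fiberExp₂ n a +
      (e 2 - γ * c.twist) • fiberExp₃ n a b := by
  conv_lhs => rw [eq_combination_fiberExp_self n a b e]
  rw [divisorExp]
  module

/-- The exponents of the monomial sections of `γ τ + β C₀ + α F`. -/
def sectionExps (n : ℕ) (γ β α : ℤ) : Set (Fin 3 → ℤ) :=
  {e | (0 ≤ e 0 ∧ e 0 + n * e 1 - e 2 ≤ α) ∧ (0 ≤ e 1 ∧ e 1 + 2 * e 2 ≤ β) ∧
    0 ≤ e 2 ∧ e 2 ≤ γ}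

/-- The global sections are spanned by monomials. The two charts `(fst, fst, fst)` and
`(snd, snd, snd)` already impose all the inequalities on their exponents. -/
theorem isSection_iff {n : ℕ} {D : (scroll n).lineBundles} {γ β α : ℤ}
    (hD : ∀ u a b c, gen D (((u, a), b), c) = laurentMonomial (divisorExp n γ β α a b c))
    (s : FunField) : IsSection D s ↔ s ∈ laurentSpan (sectionExps n γ β α) := by
  have h1 : IsSection D s ↔ ∀ q : FiberChart × FiberChart × FiberChart,
      s ∈ laurentSpan {e | e - divisorExp n γ β α q.1 q.2.1 q.2.2 ∈
        chartCone n q.1 q.2.1 q.2.2} := by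
    constructor
    · rintro h ⟨a, b, c⟩
      have h2 := h ((((), a), b), c)
      rwa [mem_scroll_ring_iff, hD, div_laurentMonomial_mem_laurentSpan] at h2
    · rintro h ⟨⟨⟨u, a⟩, b⟩, c⟩
      rw [mem_scroll_ring_iff, hD, div_laurentMonomial_mem_laurentSpan]
      exact h (a, b, c)
  have : Nonempty FiberChart := ⟨.fst⟩
  rw [h1, ← Submodule.mem_iInf, ← laurentSpan_iInter]
  suffices h : (⋂ q : FiberChart × FiberChart × FiberChart,
      {e | e - divisorExp n γ β α q.1 q.2.1 q.2.2 ∈ chartCone n q.1 q.2.1 q.2.2}) =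
        sectionExps n γ β α by rw [h]
  ext e
  simp only [Set.mem_iInter, Set.mem_ofPred_eq, sub_divisorExp_eq, combination_mem_chartCone]
  constructor
  · intro h
    obtain ⟨h1, h2, h3⟩ := h (.fst, .fst, .fst)
    obtain ⟨h4, h5, h6⟩ := h (.snd, .snd, .snd)
    simp only [FiberChart.Allows, FiberChart.twist] at h1 h2 h3 h4 h5 h6
    refine ⟨⟨?_, ?_⟩, ⟨?_, ?_⟩, ?_, ?_⟩ <;> linarith
  · rintro ⟨⟨h1, h2⟩, ⟨h3, h4⟩, h5, h6⟩ ⟨a, b, c⟩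
    refine ⟨?_, ?_, ?_⟩
    · cases a <;> simp only [FiberChart.Allows, FiberChart.twist] <;> linarith
    · cases b <;> simp only [FiberChart.Allows, FiberChart.twist] <;> linarith
    · cases c <;> simp only [FiberChart.Allows, FiberChart.twist] <;> linarith

theorem gen_scrollτ_add_A (n : ℕ) (u : Unit) (a b c : FiberChart) :
    gen (scrollτ n + scrollPullback n (hirzebruchA n)) (((u, a), b), c) =
      laurentMonomial (divisorExp n 1 2 (-1) a b c) := by
  rw [gen_add, gen_scrollτ, scrollPullback, gen_pullback, gen_hirzebruchA, ← laurentMonomial_add,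
    divisorExp]
  congr 1
  module

theorem gen_scrollC₀ (n : ℕ) (u : Unit) (a b c : FiberChart) :
    gen (scrollPullback n (hirzebruchC₀ n)) (((u, a), b), c) =
      laurentMonomial (divisorExp n 0 1 0 a b c) := by
  rw [scrollPullback, gen_pullback, gen_hirzebruchC₀, divisorExp]
  congr 1
  module

theorem gen_two_antiCanonical (n : ℕ) (u : Unit) (a b c : FiberChart) :
    gen (2 • antiCanonical n) (((u, a), b), c) =
      laurentMonomial (divisorExp n 4 8 (2 * n + 2) a b c) := by
  rw [gen_nsmul, gen_antiCanonical, ← zpow_natCast, ← laurentMonomial_zsmul, divisorExp]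
  congr 1
  push_cast
  module

/-- `x` spans the sections of `τ + A`. -/
theorem sectionExps_R (n : ℕ) : sectionExps n 1 2 (-1) = {![0, 0, 1]} := by
  ext e
  rw [Set.mem_singleton_iff, sectionExps, Set.mem_ofPred_eq]
  constructor
  · rintro ⟨⟨h1, h2⟩, ⟨h3, h4⟩, h5, h6⟩
    have h7 : 0 ≤ (n : ℤ) * e 1 := by positivity
    ext k
    fin_cases k <;> simp <;> linarith
  · rintro rfl
    simp

/-- `1` spans the sections of `C₀`, which is the negative section as `n > 0`. -/
theorem sectionExps_U (n : ℕ) (hn : 0 < n) : sectionExps n 0 1 0 = {0} := by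
  ext e
  rw [Set.mem_singleton_iff, sectionExps, Set.mem_ofPred_eq]
  constructor
  · rintro ⟨⟨h1, h2⟩, ⟨h3, h4⟩, h5, h6⟩
    have h7 : e 1 ≤ (n : ℤ) * e 1 := le_mul_of_one_le_left h3 (by exact_mod_cast hn)
    ext k
    fin_cases k <;> simp <;> linarith
  · rintro rfl
    simp

theorem exists_eq_smul_of_mem_laurentSpan_singleton {e : Fin 3 → ℤ} {s : FunField}
    (h : s ∈ laurentSpan {e}) : ∃ c : ℂ, s = c • laurentMonomial e := by
  rw [laurentSpan, Set.image_singleton, Submodule.mem_span_singleton] at h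
  obtain ⟨c, hc⟩ := h
  exact ⟨c, hc.symm⟩

theorem isSection_R (n : ℕ) :
    IsSection (scrollτ n + scrollPullback n (hirzebruchA n)) (laurentMonomial ![0, 0, 1]) := by
  rw [isSection_iff (gen_scrollτ_add_A n), sectionExps_R, laurentMonomial_mem_laurentSpan]
  rfl

theorem isSection_U (n : ℕ) (hn : 0 < n) :
    IsSection (scrollPullback n (hirzebruchC₀ n)) (laurentMonomial 0) := by
  rw [isSection_iff (gen_scrollC₀ n), sectionExps_U n hn, laurentMonomial_mem_laurentSpan]
  rfl

/-- The local equation of `R`. -/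
theorem coe_eqn_R (n : ℕ) (u : Unit) (a b c : FiberChart) :
    ((isSection_R n).eqn (((u, a), b), c) : FunField) =
      laurentMonomial ((1 - c.twist) • fiberExp₃ n a b) := by
  rw [IsSection.coe_eqn, gen_scrollτ_add_A, ← laurentMonomial_sub, sub_divisorExp_eq]
  congr 1
  simp

/-- The local equation of `U`. -/
theorem coe_eqn_U (n : ℕ) (hn : 0 < n) (u : Unit) (a b c : FiberChart) :
    ((isSection_U n hn).eqn (((u, a), b), c) : FunField) =
      laurentMonomial (-b.twist • fiberExp₂ n a) := by
  rw [IsSection.coe_eqn, gen_scrollC₀, ← laurentMonomial_sub, sub_divisorExp_eq]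
  congr 1
  simp

/-! ### The curve `σ` -/

open Pointwise in
theorem isWeaklyRegular_pair {A : Type} [CommRing A] {a b : A} (ha : IsSMulRegular A a)
    (hb : ∀ x, a ∣ b * x → a ∣ x) : RingTheory.Sequence.IsWeaklyRegular A [a, b] := by
  have hmem : ∀ x : A, x ∈ (a • ⊤ : Submodule A A) ↔ a ∣ x := by
    intro x
    rw [Submodule.mem_smul_pointwise_iff_exists]
    constructor
    · rintro ⟨y, -, rfl⟩
      exact ⟨y, rfl⟩
    · rintro ⟨y, rfl⟩
      exact ⟨y, trivial, rfl⟩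
  refine (RingTheory.Sequence.isWeaklyRegular_cons_iff A a [b]).mpr ⟨ha, ?_⟩
  refine (RingTheory.Sequence.isWeaklyRegular_cons_iff _ b []).mpr
    ⟨?_, RingTheory.Sequence.IsWeaklyRegular.nil _ _⟩
  refine IsSMulRegular.of_right_eq_zero_of_smul fun x hx => ?_
  obtain ⟨y, rfl⟩ := Submodule.Quotient.mk_surjective _ x
  rw [← Submodule.Quotient.mk_smul, Submodule.Quotient.mk_eq_zero, hmem, smul_eq_mul] at hx
  rw [Submodule.Quotient.mk_eq_zero, hmem]
  exact hb y hx

theorem mul_mem_laurentSpan_chartCone {n : ℕ} {u : Unit} {a b c : FiberChart} {f : FunField}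
    {w : Fin 3 → ℤ} {y : (scroll n).ring (((u, a), b), c)}
    (hf : f = laurentMonomial w * (y : FunField)) :
    f ∈ laurentSpan {e | e - w ∈ chartCone n a b c} := by
  rw [← div_laurentMonomial_mem_laurentSpan, hf,
    mul_div_cancel_left₀ _ (laurentMonomial_ne_zero w)]
  exact (mem_scroll_ring_iff n u a b c _).mp y.2

/-- On each chart the equations of `R` and `U` are different coordinates or units, hence form a
weakly regular sequence. -/
theorem isWeaklyRegular_eqn (n : ℕ) (hn : 0 < n) (p : (scroll n).ι) :
    RingTheory.Sequence.IsWeaklyRegular ((scroll n).ring p)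
      [(isSection_R n).eqn p, (isSection_U n hn).eqn p] := by
  obtain ⟨⟨⟨u, a⟩, b⟩, c⟩ := p
  have hR := coe_eqn_R n u a b c
  have hU := coe_eqn_U n hn u a b c
  set r := (isSection_R n).eqn (((u, a), b), c)
  set v := (isSection_U n hn).eqn (((u, a), b), c)
  apply isWeaklyRegular_pair
  · intro x y hxy
    have h := congrArg (Subtype.val) hxy
    simp only [smul_eq_mul] at h
    change (r : FunField) * x = r * y at h
    rw [hR] at h
    exact Subtype.ext (mul_left_cancel₀ (laurentMonomial_ne_zero _) h)
  · rintro x ⟨y, hy⟩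
    have h : (v : FunField) * x = r * y := congrArg Subtype.val hy
    rw [hR, hU] at h
    have h1 := mul_mem_laurentSpan_chartCone h
    rw [mul_comm, mul_laurentMonomial_mem_laurentSpan] at h1
    have h2 := (mem_scroll_ring_iff n u a b c _).mp x.2
    have h3 := Submodule.mem_inf.mpr ⟨h2, h1⟩
    rw [← laurentSpan_inter] at h3
    have h4 : (x : FunField) / laurentMonomial ((1 - c.twist) • fiberExp₃ n a b) ∈
        (scroll n).ring (((u, a), b), c) := by
      rw [mem_scroll_ring_iff, div_laurentMonomial_mem_laurentSpan]
      refine laurentSpan_mono ?_ h3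
      rintro e ⟨he1, he2⟩
      have e1 := eq_combination_fiberExp_self n a b e
      generalize e 0 + a.twist * (n * e 1 - e 2) = k₁ at e1
      generalize e 1 + 2 * b.twist * e 2 = k₂ at e1
      generalize e 2 = k₃ at e1
      subst e1
      rw [combination_mem_chartCone] at he1
      have e2 : k₁ • fiberExp₁ + k₂ • fiberExp₂ n a + k₃ • fiberExp₃ n a b +
          -b.twist • fiberExp₂ n a - (1 - c.twist) • fiberExp₃ n a b =
          k₁ • fiberExp₁ + (k₂ - b.twist) • fiberExp₂ n a +
            (k₃ - (1 - c.twist)) • fiberExp₃ n a b := by module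
      have e3 : k₁ • fiberExp₁ + k₂ • fiberExp₂ n a + k₃ • fiberExp₃ n a b -
          (1 - c.twist) • fiberExp₃ n a b =
          k₁ • fiberExp₁ + k₂ • fiberExp₂ n a +
            (k₃ - (1 - c.twist)) • fiberExp₃ n a b := by module
      simp only [Set.mem_ofPred_eq, e2, e3, combination_mem_chartCone] at he2 ⊢
      exact ⟨he1.1, he1.2.1, he2.2.2⟩
    refine ⟨⟨_, h4⟩, Subtype.ext ?_⟩
    change (x : FunField) = r * (x / _)
    rw [hR, mul_div_cancel₀ _ (laurentMonomial_ne_zero _)]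

/-- A subring that is mapped bijectively onto the quotient by an ideal `J` yields a retraction with
kernel `J`. -/
theorem exists_retraction {K : Type} [Field K] [Algebra ℂ K] {A B : Subalgebra ℂ K} (h : B ≤ A)
    (J : Ideal A) (hsurj : ∀ a : A, ∃ b : B, a - Subalgebra.inclusion h b ∈ J)
    (hinj : ∀ b : B, Subalgebra.inclusion h b ∈ J → b = 0) :
    ∃ ρ : A →+* B, (∀ (b : B) (a : A), (a : K) = b → ρ a = b) ∧ RingHom.ker ρ = J := by
  let f : B →+* A ⧸ J := (Ideal.Quotient.mk J).comp (Subalgebra.inclusion h).toRingHom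
  have hf : Function.Bijective f := by
    constructor
    · refine (injective_iff_map_eq_zero f).mpr fun b hb => hinj b ?_
      exact Ideal.Quotient.eq_zero_iff_mem.mp hb
    · intro q
      obtain ⟨a, rfl⟩ := Ideal.Quotient.mk_surjective q
      obtain ⟨b, hb⟩ := hsurj a
      exact ⟨b, (Ideal.Quotient.eq.mpr hb).symm⟩
  let e := RingEquiv.ofBijective f hf
  refine ⟨(e.symm : A ⧸ J →+* B).comp (Ideal.Quotient.mk J), ?_, ?_⟩
  · intro b a hab
    obtain rfl : a = Subalgebra.inclusion h b := Subtype.ext hab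
    exact e.symm_apply_apply b
  · rw [← RingHom.comap_ker]
    have : RingHom.ker (e.symm : A ⧸ J →+* B) = ⊥ :=
      (RingHom.injective_iff_ker_eq_bot _).mp e.symm.injective
    rw [this, ← RingHom.ker_eq_comap_bot, Ideal.mk_ker]

theorem projLine_ring_le (n : ℕ) (p : (scroll n).ι) :
    projLine.ring p.1.1 ≤ (scroll n).ring p :=
  le_sup_left.trans (le_sup_left (a := (hirzebruch n).ring p.1))

/-- The coordinate ring of a chart of `ℙ¹` is a complement of the ideal of `σ` on the chart of `X`
lying over it: modulo the equations of `R` and `U` only the powers of `z` survive. -/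
theorem exists_retraction_of_mem_iff {n : ℕ} {a : FiberChart} {A B : Subalgebra ℂ FunField}
    (hle : B ≤ A) (hA : ∀ x, x ∈ A ↔ x ∈ laurentSpan (chartCone n a .snd .fst))
    (hB : ∀ x, x ∈ B ↔ x ∈ laurentSpan {e | a.Allows (e 0) ∧ e 1 = 0 ∧ e 2 = 0}) (r v : A)
    (hR : (r : FunField) = laurentMonomial (fiberExp₃ n a .snd))
    (hU : (v : FunField) = laurentMonomial (-fiberExp₂ n a)) :
    ∃ ρ : A →+* B, (∀ (b : B) (a : A), (a : FunField) = b → ρ a = b) ∧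
      RingHom.ker ρ = Ideal.span {r} ⊔ Ideal.span {v} := by
  have hA' : ∀ e, laurentMonomial e ∈ A ↔ e ∈ chartCone n a .snd .fst := fun e => by
    rw [hA, laurentMonomial_mem_laurentSpan]
  set J := Ideal.span {r} ⊔ Ideal.span {v} with hJ
  refine exists_retraction hle J ?_ ?_
  · suffices h : ∀ x ∈ laurentSpan (chartCone n a .snd .fst),
        ∃ (h : x ∈ A) (b : B),
          (⟨x, h⟩ : A) - Subalgebra.inclusion hle b ∈ J by
      intro x
      obtain ⟨h1, h2⟩ := h x ((hA _).mp x.2)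
      exact h2
    intro x hx
    induction hx using Submodule.span_induction with
    | mem x hx =>
      obtain ⟨e, he, rfl⟩ := hx
      have hm := (hA' e).mpr he
      refine ⟨hm, ?_⟩
      obtain ⟨h1, h2, h3⟩ := he
      simp only [FiberChart.Allows, FiberChart.twist] at h2 h3
      have e1 : e = (e 0 + a.twist * (n * e 1 - e 2)) • fiberExp₁ +
          (e 1 + 2 * 1 * e 2) • fiberExp₂ n a + e 2 • fiberExp₃ n a .snd :=
        eq_combination_fiberExp_self n a .snd e
      by_cases h30 : e 2 = 0
      · by_cases h20 : e 1 + 2 * 1 * e 2 = 0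
        · refine ⟨⟨laurentMonomial e, ?_⟩, ?_⟩
          · rw [hB, laurentMonomial_mem_laurentSpan]
            have h10 : e 1 = 0 := by omega
            exact ⟨by simpa [h10, h30] using h1, h10, h30⟩
          · convert Ideal.zero_mem J
            exact sub_eq_zero.mpr rfl
        · refine ⟨0, ?_⟩
          rw [map_zero, sub_zero]
          refine Ideal.mem_sup_right (Ideal.mem_span_singleton.mpr ⟨⟨laurentMonomial
            (e + fiberExp₂ n a), ?_⟩, Subtype.ext ?_⟩)
          · rw [hA']
            rw [show e + fiberExp₂ n a = (e 0 + a.twist * (n * e 1 - e 2)) • fiberExp₁ +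
              (e 1 + 2 * 1 * e 2 + 1) • fiberExp₂ n a + e 2 • fiberExp₃ n a .snd by
                conv_lhs => rw [e1]
                module, combination_mem_chartCone]
            refine ⟨h1, ?_, h3⟩
            simp only [FiberChart.Allows]
            omega
          · change laurentMonomial e = v * laurentMonomial (e + fiberExp₂ n a)
            rw [hU, ← laurentMonomial_add]
            congr 1
            abel
      · refine ⟨0, ?_⟩
        rw [map_zero, sub_zero]
        refine Ideal.mem_sup_left (Ideal.mem_span_singleton.mpr ⟨⟨laurentMonomial
          (e - fiberExp₃ n a .snd), ?_⟩, Subtype.ext ?_⟩)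
        · rw [hA']
          rw [show e - fiberExp₃ n a .snd = (e 0 + a.twist * (n * e 1 - e 2)) • fiberExp₁ +
            (e 1 + 2 * 1 * e 2) • fiberExp₂ n a + (e 2 - 1) • fiberExp₃ n a .snd by
              conv_lhs => rw [e1]
              module, combination_mem_chartCone]
          refine ⟨h1, h2, ?_⟩
          simp only [FiberChart.Allows]
          omega
        · change laurentMonomial e = r * laurentMonomial (e - fiberExp₃ n a .snd)
          rw [hR, ← laurentMonomial_add]
          congr 1
          abel
    | zero => exact ⟨zero_mem _, 0, by convert Ideal.zero_mem J; exact sub_eq_zero.mpr rfl⟩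
    | add x y _ _ hx hy =>
      obtain ⟨hx, b, hb⟩ := hx
      obtain ⟨hy, b', hb'⟩ := hy
      refine ⟨add_mem hx hy, b + b', ?_⟩
      convert Ideal.add_mem J hb hb' using 1
      rw [map_add, sub_add_sub_comm]
      rfl
    | smul c x _ hx =>
      obtain ⟨hx, b, hb⟩ := hx
      refine ⟨Subalgebra.smul_mem _ hx c, c • b, ?_⟩
      convert J.mul_mem_left (algebraMap ℂ _ c) hb using 1
      rw [← Algebra.smul_def, smul_sub, map_smul]
      rfl
  · intro b hb
    obtain ⟨f, g, hfg⟩ := Ideal.mem_span_pair.mp (show _ ∈ Ideal.span {r, v} by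
      rwa [Ideal.span_insert])
    have h : (f : FunField) * r + g * v = b := congrArg Subtype.val hfg
    rw [hR, hU] at h
    have hf : (f : FunField) * laurentMonomial (fiberExp₃ n a .snd) ∈
        laurentSpan {e | e 1 ≠ 0 ∨ e 2 ≠ 0} := by
      rw [mul_laurentMonomial_mem_laurentSpan]
      refine laurentSpan_mono ?_ ((hA _).mp f.2)
      rintro e ⟨-, -, h3⟩
      right
      simp only [FiberChart.Allows] at h3
      simp only [fiberExp₃, Pi.add_apply, Matrix.cons_val]
      omega
    have hg : (g : FunField) * laurentMonomial (-fiberExp₂ n a) ∈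
        laurentSpan {e | e 1 ≠ 0 ∨ e 2 ≠ 0} := by
      rw [mul_laurentMonomial_mem_laurentSpan]
      refine laurentSpan_mono ?_ ((hA _).mp g.2)
      rintro e ⟨-, h2, h3⟩
      simp only [FiberChart.Allows, FiberChart.twist] at h2 h3
      simp only [fiberExp₂, Set.mem_ofPred_eq, Pi.add_apply, Pi.neg_apply, Matrix.cons_val]
      omega
    have h1 := add_mem hf hg
    rw [h] at h1
    have h2 := Submodule.mem_inf.mpr ⟨h1, (hB _).mp b.2⟩
    rw [← laurentSpan_inter] at h2
    have h3 : ({e | e 1 ≠ 0 ∨ e 2 ≠ 0} ∩ {e | a.Allows (e 0) ∧ e 1 = 0 ∧ e 2 = 0} :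
        Set (Fin 3 → ℤ)) = ∅ := by
      ext e
      simp only [Set.mem_inter_iff, Set.mem_ofPred_eq, Set.mem_empty_iff_false, iff_false]
      tauto
    rw [h3, laurentSpan_empty, Submodule.mem_bot] at h2
    exact Subtype.ext h2

/-- On the charts meeting `σ`, restriction to `σ` followed by the projection to `ℙ¹` gives a
retraction onto the coordinate ring of the chart of `ℙ¹`. -/
theorem exists_retraction_scroll (n : ℕ) (hn : 0 < n) (k : projLine.ι) :
    ∃ ρ : (scroll n).ring ((k, .snd), .fst) →+* projLine.ring k,
      (∀ (b : projLine.ring k) (a : (scroll n).ring ((k, .snd), .fst)),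
        (a : FunField) = b → ρ a = b) ∧
      RingHom.ker ρ = Ideal.span {(isSection_R n).eqn ((k, .snd), .fst)} ⊔
        Ideal.span {(isSection_U n hn).eqn ((k, .snd), .fst)} := by
  obtain ⟨u, a⟩ := k
  refine exists_retraction_of_mem_iff (projLine_ring_le n (((u, a), .snd), .fst))
    (mem_scroll_ring_iff n u a .snd .fst) (mem_projLine_ring_iff u a) _ _ ?_ ?_
  · rw [coe_eqn_R, FiberChart.twist, sub_zero, one_smul]
  · rw [coe_eqn_U n hn, FiberChart.twist, neg_smul, one_smul]

/-- Away from the charts of the form `(a, snd, fst)` one of the two equations is a unit. -/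
theorem eq_top_of_ne (n : ℕ) (hn : 0 < n) (p : (scroll n).ι)
    (hp : ¬ ∃ k : projLine.ι, p = ((k, .snd), .fst)) :
    Ideal.span {(isSection_R n).eqn p} ⊔ Ideal.span {(isSection_U n hn).eqn p} = ⊤ := by
  obtain ⟨⟨⟨u, a⟩, b⟩, c⟩ := p
  have hR := coe_eqn_R n u a b c
  have hU := coe_eqn_U n hn u a b c
  have key : ∀ (f : (scroll n).ring (((u, a), b), c)) (w : Fin 3 → ℤ),
      (f : FunField) = laurentMonomial w → -w ∈ chartCone n a b c → Ideal.span {f} = ⊤ := by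
    intro f w hf hw
    rw [Ideal.span_singleton_eq_top]
    refine IsUnit.of_mul_eq_one ⟨laurentMonomial (-w),
      (laurentMonomial_mem_scroll_ring_iff n u a b c _).mpr hw⟩ (Subtype.ext ?_)
    change (f : FunField) * laurentMonomial (-w) = 1
    rw [hf, ← laurentMonomial_add, add_neg_cancel, laurentMonomial_zero]
  by_cases hc : c = .fst
  · have hb : b ≠ .snd := fun hb => hp ⟨(u, a), by rw [hb, hc]⟩
    rw [key _ _ hU, sup_top_eq]
    have h0 : b.twist = 0 := by cases b <;> first | rfl | exact absurd rfl hb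
    have := (combination_mem_chartCone n a b c 0 0 0).mpr
      (by cases a <;> cases b <;> cases c <;> simp [FiberChart.Allows])
    simpa [h0] using this
  · rw [key _ _ hR, top_sup_eq]
    have := (combination_mem_chartCone n a b c 0 0 (-(1 - c.twist))).mpr
      (by cases a <;> cases b <;> cases c <;> simp [FiberChart.Allows, FiberChart.twist] at hc ⊢)
    simpa only [zero_smul, zero_add, neg_smul] using this

/-! ### The base locus -/

/-- Every section of `-2K_X` vanishes along `σ`: a monomial without the factor `x` has degree
`j` with `n j ≤ 2 n + 2` in the fibre coordinate of `𝔽ₙ`, hence `j < 8` and it vanishes on `C₀`. -/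
theorem eqn_mem_of_mem (n : ℕ) (hn : 0 < n) (p : (scroll n).ι) (I : Ideal ((scroll n).ring p))
    (hRI : (isSection_R n).eqn p ∈ I) (hUI : (isSection_U n hn).eqn p ∈ I) (s : FunField)
    (hs : IsSection (2 • antiCanonical n) s) : hs.eqn p ∈ I := by
  obtain ⟨⟨⟨u, a⟩, b⟩, c⟩ := p
  have hR := coe_eqn_R n u a b c
  have hU := coe_eqn_U n hn u a b c
  set r := (isSection_R n).eqn (((u, a), b), c)
  set v := (isSection_U n hn).eqn (((u, a), b), c)
  suffices h : ∀ x ∈ laurentSpan (sectionExps n 4 8 (2 * n + 2)),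
      ∃ h : x / laurentMonomial (divisorExp n 4 8 (2 * n + 2) a b c) ∈
        (scroll n).ring (((u, a), b), c), (⟨_, h⟩ : (scroll n).ring (((u, a), b), c)) ∈ I by
    obtain ⟨h1, h2⟩ := h s ((isSection_iff (gen_two_antiCanonical n) s).mp hs)
    convert h2
    rw [IsSection.coe_eqn, gen_two_antiCanonical]
  intro x hx
  induction hx using Submodule.span_induction with
  | mem x hx =>
    obtain ⟨e, he, rfl⟩ := hx
    have hmem := (isSection_iff (gen_two_antiCanonical n) (laurentMonomial e)).mpr
      (laurentMonomial_mem_laurentSpan.mpr he) (((u, a), b), c)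
    rw [gen_two_antiCanonical] at hmem
    refine ⟨hmem, ?_⟩
    rw [← laurentMonomial_sub, laurentMonomial_mem_scroll_ring_iff, sub_divisorExp_eq,
      combination_mem_chartCone] at hmem
    obtain ⟨h1, h2, h3⟩ := hmem
    -- it is enough to divide by one of the two equations
    have key : ∀ (f : (scroll n).ring (((u, a), b), c)) (w : Fin 3 → ℤ), f ∈ I →
        (f : FunField) = laurentMonomial w →
        e - divisorExp n 4 8 (2 * n + 2) a b c - w ∈ chartCone n a b c →
        ∀ h, (⟨laurentMonomial e / laurentMonomial (divisorExp n 4 8 (2 * n + 2) a b c), h⟩ :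
          (scroll n).ring (((u, a), b), c)) ∈ I := by
      intro f w hf hw hc h
      convert I.mul_mem_right (⟨_, (laurentMonomial_mem_scroll_ring_iff n u a b c _).mpr hc⟩) hf
      change _ = (f : FunField) * laurentMonomial _
      rw [hw, ← laurentMonomial_sub, ← laurentMonomial_add]
      congr 1
      abel
    obtain ⟨⟨h4, h5⟩, ⟨h6, h7⟩, h8, h9⟩ := he
    by_cases hce : c = .fst ∧ e 2 = 0
    · refine key v _ hUI hU ?_ _
      obtain ⟨rfl, he2⟩ := hce
      have h10 : e 1 < 8 := by
        by_contra h
        have h11 : (1 : ℤ) ≤ n := by exact_mod_cast hn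
        have h12 : (8 : ℤ) ≤ e 1 := by omega
        have h13 : (n : ℤ) * 8 ≤ n * e 1 := mul_le_mul_of_nonneg_left h12 (by omega)
        omega
      have := (combination_mem_chartCone n a b .fst _
        (e 1 + 2 * b.twist * e 2 - 8 * b.twist + b.twist) _).mpr ⟨h1, ?_, h3⟩
      · convert this using 1
        rw [sub_divisorExp_eq]
        module
      · rw [he2] at h2 ⊢
        cases b <;> simp only [FiberChart.Allows, FiberChart.twist] at h2 ⊢ <;> omega
    · refine key r _ hRI hR ?_ _
      have := (combination_mem_chartCone n a b c _ _
        (e 2 - 4 * c.twist - (1 - c.twist))).mpr ⟨h1, h2, ?_⟩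
      · convert this using 1
        rw [sub_divisorExp_eq]
        module
      · cases c <;> simp only [FiberChart.Allows, FiberChart.twist, true_and, reduceCtorEq,
          false_and, not_false_eq_true] at h3 hce ⊢ <;> omega
  | zero =>
    simp only [zero_div]
    exact ⟨zero_mem _, I.zero_mem⟩
  | add x y _ _ hx hy =>
    obtain ⟨hx, hx'⟩ := hx
    obtain ⟨hy, hy'⟩ := hy
    simp only [add_div]
    exact ⟨add_mem hx hy, I.add_mem hx' hy'⟩
  | smul k x _ hx =>
    obtain ⟨hx, hx'⟩ := hx
    simp only [smul_div_assoc]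
    refine ⟨Subalgebra.smul_mem _ hx k, ?_⟩
    convert I.mul_mem_left (algebraMap ℂ _ k) hx' using 1
    rw [← Algebra.smul_def]
    rfl

/-- The sections `zⁱ x⁴`, `zⁱ` and `zⁱ y²` of `-2K_X`, for suitable `i`, have no common zero outside
`σ`: on each chart one of the first kind is the fourth power of the equation of `R`, and where `R`
is not empty, one of the others is the sixth power of the equation of `U`. -/
theorem mem_of_forall_eqn_mem (n : ℕ) (hn : 0 < n) (p : (scroll n).ι)
    (I : Ideal ((scroll n).ring p)) (hI : I.IsPrime)
    (h : ∀ s (hs : IsSection (2 • antiCanonical n) s), hs.eqn p ∈ I) :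
    (isSection_R n).eqn p ∈ I ∧ (isSection_U n hn).eqn p ∈ I := by
  obtain ⟨⟨⟨u, a⟩, b⟩, c⟩ := p
  have hR := coe_eqn_R n u a b c
  have hU := coe_eqn_U n hn u a b c
  set r := (isSection_R n).eqn (((u, a), b), c)
  set v := (isSection_U n hn).eqn (((u, a), b), c)
  have key : ∀ (f : (scroll n).ring (((u, a), b), c)) (w e : Fin 3 → ℤ) (m : ℕ),
      (f : FunField) = laurentMonomial w → e ∈ sectionExps n 4 8 (2 * n + 2) →
      e - divisorExp n 4 8 (2 * n + 2) a b c = (m : ℤ) • w → f ∈ I := by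
    intro f w e m hf he hw
    have hs := (isSection_iff (gen_two_antiCanonical n) (laurentMonomial e)).mpr
      (laurentMonomial_mem_laurentSpan.mpr he)
    have h1 : f ^ m = hs.eqn (((u, a), b), c) := by
      apply Subtype.ext
      rw [IsSection.coe_eqn, gen_two_antiCanonical, ← laurentMonomial_sub, hw,
        laurentMonomial_zsmul, ← hf, zpow_natCast]
      rfl
    exact hI.mem_of_pow_mem m (h1 ▸ h _ hs)
  have hn' : (1 : ℤ) ≤ n := by exact_mod_cast hn
  have hrI : r ∈ I := by
    refine key r _ ![(2 * n + 6) * a.twist, 0, 4] 4 hR ?_ ?_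
    · cases a <;> simp [sectionExps, FiberChart.twist] <;> omega
    · rw [sub_divisorExp_eq]
      simp only [Matrix.cons_val]
      module
  refine ⟨hrI, ?_⟩
  have hc : c.twist = 0 := by
    cases c
    · rfl
    · -- on this chart `r` is `1`
      refine absurd ((Ideal.eq_top_iff_one I).mpr ?_) hI.ne_top
      convert hrI
      apply Subtype.ext
      change (1 : FunField) = r
      rw [hR]
      simp [FiberChart.twist, laurentMonomial_zero]
    · rfl
  refine key v _ ![a.twist * (2 * n + 2 - 2 * n * b.twist), 2 * b.twist, 0] 6 hU ?_ ?_
  · cases a <;> cases b <;> simp [sectionExps, FiberChart.twist] <;> omega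
  · rw [sub_divisorExp_eq, hc]
    simp only [Matrix.cons_val]
    module

theorem mainTheorem5 (n : ℕ) (hn : 0 < n) :
    ∃ R U : (scroll n).toScheme.IdealSheafData,
      Atlas.linearSystem (scrollτ n + scrollPullback n (hirzebruchA n)) = {R} ∧
      Atlas.linearSystem (scrollPullback n (hirzebruchC₀ n)) = {U} ∧
      Atlas.IntersectCompletely R U ∧
      (∃ e : (R ⊔ U).subscheme ≅ projLine.toScheme,
        e.hom ≫ projLine.structureMap = (R ⊔ U).subschemeι ≫ (scroll n).structureMap) ∧
      Atlas.baseLocus ((scroll n).antiCanonicalSystem 3 2) =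
        ((R ⊔ U).support : Set (scroll n).toScheme) := by
  obtain ⟨R, hR, hRs⟩ := exists_linearSystem_eq_singleton (isSection_R n)
    (laurentMonomial_ne_zero _) fun s hs => exists_eq_smul_of_mem_laurentSpan_singleton (by
      rwa [isSection_iff (gen_scrollτ_add_A n), sectionExps_R] at hs)
  obtain ⟨U, hU, hUs⟩ := exists_linearSystem_eq_singleton (isSection_U n hn)
    (laurentMonomial_ne_zero _) fun s hs => exists_eq_smul_of_mem_laurentSpan_singleton (by
      rwa [isSection_iff (gen_scrollC₀ n), sectionExps_U n hn] at hs)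
  refine ⟨R, U, hRs, hUs, fun p => ⟨_, _, hR p, hU p, isWeaklyRegular_eqn n hn p⟩, ?_, ?_⟩
  · choose ρ hρ hker using exists_retraction_scroll n hn
    exact exists_iso_of_retraction (𝒜 := scroll n) (ℬ := projLine) (fun p => p.1.1)
      (fun p q h => h.1.1) (projLine_ring_le n) (fun k => ((k, .snd), .fst))
      (fun k l h => ⟨⟨h, le_rfl⟩, le_rfl⟩) (fun k => le_rfl) ρ hρ (hR.sup hU)
      (fun k => (hker k).symm)
      (fun p => or_iff_not_imp_left.mpr fun hp => eq_top_of_ne n hn p hp)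
  · rw [antiCanonicalSystem_scroll]
    ext x
    obtain ⟨p, q, rfl⟩ := (scroll n).exists_chart_eq x
    rw [chart_mem_baseLocus_linearSystem, SetLike.mem_coe, (hR.sup hU).mem_support_iff, sup_le_iff,
      Ideal.span_singleton_le_iff_mem, Ideal.span_singleton_le_iff_mem]
    exact ⟨mem_of_forall_eqn_mem n hn p _ (PrimeSpectrum.isPrime q),
      fun h s hs => eqn_mem_of_mem n hn p _ h.1 h.2 s hs⟩

end
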